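/- Let $q\ge 1$, let $\Omega_q$ be the unit sphere of $\mathbb{R}^{q+1}$ with surface measure $\omega_q$, and let $(\mathbf X_i,Y_i)$, $i\ge 1$, be i.i.d. in $\Omega_q\times\mathbb{R}$ with $Y_i=m(\mathbf X_i)+\sigma(\mathbf X_i)\varepsilon_i$, where $\mathbf X_i$ has density $f$ with respect to $\omega_q$, $\sigma\ge 0$, $\mathbb{E}[\varepsilon_i\mid \mathbf X_i]=0$, $\mathbb{E}[\varepsilon_i^2\mid \mathbf X_i]=1$, and $\mathbb{E}[|\varepsilon_i|^3\mid \mathbf X_i]$, $\mathbb{E}[\varepsilon_i^4\mid \mathbf X_i]$ are bounded. Assume: (A1) the radial extensions $\mathbf y\mapsto m(\mathbf y/\|\mathbf y\|)$ and $\mathbf y\mapsto f(\mathbf y/\|\mathbf y\|)$ are of class $C^3$, respectively $C^2$, on $\mathbb{R}^{q+1}\setminus\{\mathbf 0\}$, and $f$ is bounded away from zero; (A2) $\sigma^2$ is uniformly continuous and bounded away from zero; (A3) $L:[0,\infty)\to[0,\infty)$ is continuous, bounded, not identically zero, and $L(r)\le Me^{-\alpha r}$ for all $r\ge 0$, with some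 $M,\alpha>0$; (A4) $h=h_n>0$, $h\to 0$ and $nh^q\to\infty$. Let $\omega_{q-1}=2\pi^{q/2}/\Gamma(q/2)$, $$\lambda_{h,q}(L)=\omega_{q-1}\int_0^{2h^{-2}}L(r)r^{\frac q2-1}(2-rh^2)^{\frac q2-1}\,dr,\qquad \lambda_q(L)=2^{\frac q2-1}\omega_{q-1}\int_0^\infty L(r)r^{\frac q2-1}\,dr,$$ and $L_h(\mathbf x,\mathbf y)=(\lambda_{h,q}(L)h^q)^{-1}L\big((1-\mathbf x^T\mathbf y)/h^2\big)$. For $\mathbf x\in\Omega_q$ let $\mathbf B_{\mathbf x}$ be a $(q+1)\times q$ matrix whose columns complete $\mathbf x$ to an orthonormal basis of $\mathbb{R}^{q+1}$. Let $\mathcal W_{\mathbf x}=\mathrm{diag}(L_h(\mathbf x,\mathbf X_1),\dots,L_h(\mathbf x,\mathbf X_n))$, let $\mathcal X_{\mathbf x,0}$ be the column of $n$ ones, and let $\mathcal X_{\mathbf x,1}$ be the $n\times(q+1)$ matrix with rows $(1,(\mathbf X_i-\mathbf x)^T\mathbf B_{\mathbf x})$. With $\mathbf Y=(Y_1,\dots,Y_n)^T$,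 the projected local estimator is $$\hat m_{h,p}(\mathbf x)=\mathbf e_1^T(\mathcal X_{\mathbf x,p}^T\mathcal W_{\mathbf x}\mathcal X_{\mathbf x,p})^{-1}\mathcal X_{\mathbf x,p}^T\mathcal W_{\mathbf x}\mathbf Y,\qquad p=0,1$$ (with the convention that it is $0$ when the matrix is singular). Put $$L_h^*(\mathbf x,\mathbf X_i)=\frac{1}{nh^q\lambda_q(L)f(\mathbf x)}L\Big(\frac{1-\mathbf x^T\mathbf X_i}{h^2}\Big),$$ the same for $p=0$ and $p=1$. Here "$R_n(\mathbf x)=o_{\mathbb P}(1)$ uniformly in $\mathbf x\in S$" means $\sup_{\mathbf x\in S}\mathbb P(|R_n(\mathbf x)|\ge\delta)\to 0$ for every $\delta>0$. Then, for $p=0$ and for $p=1$: 1. $\sup_{\mathbf x\in\Omega_q}\mathbb P\big(\mathcal X_{\mathbf x,p}^T\mathcal W_{\mathbf x}\mathcal X_{\mathbf x,p}\text{ is singular}\big)\to 0$. 2. There are random variables $r_{n,i}(\mathbf x)$ with $$\hat m_{h,p}(\mathbf x)=\sum_{i=1}^n L_h^*(\mathbf x,\mathbf X_i)\,Y_i\,\big(1+r_{n,i}(\mathbf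 x)\big)\ \text{ for all } n \text{ and } \mathbf x,\qquad \max_{1\le i\le n}|r_{n,i}(\mathbf x)|=o_{\mathbb P}(1)\ \text{ uniformly in }\mathbf x\in\Omega_q.$$ 3. Let $S\subseteq\Omega_q$ be arbitrary if $p=0$, and such that $\inf_{S}|m|>0$ if $p=1$. Then the factor can be taken common to all terms: there are random variables $R_n(\mathbf x)$ with $R_n(\mathbf x)=o_{\mathbb P}(1)$ uniformly in $\mathbf x\in S$ and $$\sup_{\mathbf x\in S}\mathbb P\Big(\hat m_{h,p}(\mathbf x)\ne\big(1+R_n(\mathbf x)\big)\sum_{i=1}^n L_h^*(\mathbf x,\mathbf X_i)Y_i\Big)\to 0 .$$ -/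

import Mathlib

open MeasureTheory ProbabilityTheory Filter Topology

noncomputable section

namespace DirReg

open scoped Matrix

/-- The ambient Euclidean space `ℝ^(q+1)`. -/
abbrev Amb (q : ℕ) : Type := EuclideanSpace ℝ (Fin (q + 1))

/-- The unit `q`-sphere in `ℝ^(q+1)`. -/
abbrev Sph (q : ℕ) : Type := Metric.sphere (0 : Amb q) 1

/-- The surface (Lebesgue) measure on the `q`-sphere. -/
def surfaceMeasure (q : ℕ) : Measure (Sph q) := (volume : Measure (Amb q)).toSphere

/-- The surface area `2 π^(q/2) / Γ(q/2)` of the `(q-1)`-sphere in `ℝ^q`, for `q ≥ 1`. -/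
def lowerArea (q : ℕ) : ℝ := 2 * Real.pi ^ ((q : ℝ) / 2) / Real.Gamma ((q : ℝ) / 2)

/-- `λ_{h,q}(L)`, with `h ^ q * λ_{h,q}(L)` the integral over the sphere of
`y ↦ L((1 - xᵀy) / h²)`. -/
def kernelMassAt (q : ℕ) (L : ℝ → ℝ) (h : ℝ) : ℝ :=
  lowerArea q *
    ∫ r in (0 : ℝ)..(2 / h ^ 2),
      L r * r ^ ((q : ℝ) / 2 - 1) * (2 - r * h ^ 2) ^ ((q : ℝ) / 2 - 1)

/-- `λ_q(L)`, the limit of `λ_{h,q}(L)` as `h → 0`. -/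
def kernelMass (q : ℕ) (L : ℝ → ℝ) : ℝ :=
  (2 : ℝ) ^ ((q : ℝ) / 2 - 1) * lowerArea q *
    ∫ r in Set.Ioi (0 : ℝ), L r * r ^ ((q : ℝ) / 2 - 1)

/-- The normalised directional kernel `L_h(x, y) = c_{h,q}(L) L((1 - xᵀy) / h²)`, where
`c_{h,q}(L)⁻¹ = λ_{h,q}(L) h^q`. -/
def dirKernel {q : ℕ} (L : ℝ → ℝ) (h : ℝ) (x y : Sph q) : ℝ :=
  (kernelMassAt q L h * h ^ q)⁻¹ * L ((1 - inner ℝ (x : Amb q) (y : Amb q)) / h ^ 2)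

/-- The equivalent kernel
`L*_h(x, y) = L((1 - xᵀy) / h²) / (n h^q λ_q(L) f(x))`. -/
def equivKernel {q : ℕ} (L : ℝ → ℝ) (f : Sph q → ℝ) (n : ℕ) (h : ℝ) (x y : Sph q) : ℝ :=
  1 / ((n : ℝ) * h ^ q * kernelMass q L * f x) *
    L ((1 - inner ℝ (x : Amb q) (y : Amb q)) / h ^ 2)

/-- `B` is a projection matrix at `x`: its `q` columns complete `x` to an orthonormal basis of
`ℝ^(q+1)` (`q + 1` orthonormal vectors automatically form a basis). -/
def IsProjectionMatrix {q : ℕ} (x : Sph q) (B : Matrix (Fin (q + 1)) (Fin q) ℝ) : Prop :=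
  Orthonormal ℝ
    (Fin.cons (x : Amb q) (fun j => WithLp.toLp 2 (fun k => B k j)) : Fin (q + 1) → Amb q)

section Estimator

variable {q n : ℕ}

/-- The design matrix of the local fit of degree `p`. There are `1 + p q` columns: a column of ones
and, for `p = 1`, the `q` columns whose `i`-th row is `(X_i - x)ᵀ B`. -/
def designMatrix (p : ℕ) (B : Matrix (Fin (q + 1)) (Fin q) ℝ) (x : Sph q) (X : Fin n → Sph q) :
    Matrix (Fin n) (Unit ⊕ (Fin p × Fin q)) ℝ :=
  Matrix.of fun i => Sum.elim (fun _ => 1)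
    (fun jk => (Bᵀ *ᵥ WithLp.ofLp ((X i : Amb q) - (x : Amb q))) jk.2)

/-- The weight matrix `diag(L_h(x, X_1), …, L_h(x, X_n))`. -/
def weightMatrix (L : ℝ → ℝ) (h : ℝ) (x : Sph q) (X : Fin n → Sph q) :
    Matrix (Fin n) (Fin n) ℝ :=
  Matrix.diagonal fun i => dirKernel L h x (X i)

/-- The matrix `𝒳ᵀ 𝒲 𝒳` of the weighted least squares problem. -/
def normalMatrix (p : ℕ) (L : ℝ → ℝ) (h : ℝ) (B : Matrix (Fin (q + 1)) (Fin q) ℝ) (x : Sph q)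
    (X : Fin n → Sph q) : Matrix (Unit ⊕ (Fin p × Fin q)) (Unit ⊕ (Fin p × Fin q)) ℝ :=
  (designMatrix p B x X)ᵀ * weightMatrix L h x X * designMatrix p B x X

/-- The weight `W_n^p(x, X_i) = e₁ᵀ (𝒳ᵀ 𝒲 𝒳)⁻¹ 𝒳ᵀ 𝒲 e_i`. -/
def localWeight (p : ℕ) (L : ℝ → ℝ) (h : ℝ) (B : Matrix (Fin (q + 1)) (Fin q) ℝ) (x : Sph q)
    (X : Fin n → Sph q) (i : Fin n) : ℝ :=
  ((normalMatrix p L h B x X)⁻¹ * (designMatrix p B x X)ᵀ * weightMatrix L h x X) (Sum.inl ()) i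

/-- The projected local estimator `e₁ᵀ (𝒳ᵀ 𝒲 𝒳)⁻¹ 𝒳ᵀ 𝒲 Y` at `x`. -/
def localEstimator (p : ℕ) (L : ℝ → ℝ) (h : ℝ) (B : Matrix (Fin (q + 1)) (Fin q) ℝ) (x : Sph q)
    (X : Fin n → Sph q) (Y : Fin n → ℝ) : ℝ :=
  (((normalMatrix p L h B x X)⁻¹ * (designMatrix p B x X)ᵀ * weightMatrix L h x X) *ᵥ Y)
    (Sum.inl ())

/-- The estimator is linear in the responses, with weights `localWeight`. -/
theorem localEstimator_eq_sum (p : ℕ) (L : ℝ → ℝ) (h : ℝ) (B : Matrix (Fin (q + 1)) (Fin q) ℝ)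
    (x : Sph q) (X : Fin n → Sph q) (Y : Fin n → ℝ) :
    localEstimator p L h B x X Y = ∑ i, localWeight p L h B x X i * Y i := rfl

end Estimator

/-- The radial extension `y ↦ g(y / ‖y‖)` of a function on the sphere to `ℝ^(q+1) \ {0}` (the value
at the origin is irrelevant). -/
def radialExt {q : ℕ} (g : Sph q → ℝ) (y : Amb q) : ℝ :=
  if hy : y = 0 then 0
  else g ⟨‖y‖⁻¹ • y, by
    rw [mem_sphere_zero_iff_norm, norm_smul, norm_inv, norm_norm,
      inv_mul_cancel₀ (norm_ne_zero_iff.mpr hy)]⟩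

/-- Regularity of the regression function `m` and of the design density `f`. -/
structure SmoothDesign {q : ℕ} (m f : Sph q → ℝ) : Prop where
  contDiff_m : ContDiffOn ℝ 3 (radialExt m) {0}ᶜ
  contDiff_f : ContDiffOn ℝ 2 (radialExt f) {0}ᶜ
  f_lower : ∃ c : ℝ, 0 < c ∧ ∀ x, c ≤ f x

/-- Regularity of the conditional standard deviation `σ`. -/
structure RegularNoise {q : ℕ} (σ : Sph q → ℝ) : Prop where
  nonneg : ∀ x, 0 ≤ σ x
  uniformContinuous_sq : UniformContinuous fun x => σ x ^ 2
  sq_lower : ∃ c : ℝ, 0 < c ∧ ∀ x, c ≤ σ x ^ 2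

/-- `L` (of which only the restriction to `[0, ∞)` matters) is a directional kernel: nonnegative,
not identically zero, continuous, bounded and with exponential decay. -/
structure IsDirectionalKernel (L : ℝ → ℝ) : Prop where
  continuousOn : ContinuousOn L (Set.Ici 0)
  nonneg : ∀ r, 0 ≤ r → 0 ≤ L r
  nontrivial : ∃ r, 0 ≤ r ∧ L r ≠ 0
  bounded : ∃ K : ℝ, ∀ r, 0 ≤ r → L r ≤ K
  decay : ∃ M α : ℝ, 0 < M ∧ 0 < α ∧ ∀ r, 0 ≤ r → L r ≤ M * Real.exp (-α * r)

/-- Conditions on the bandwidth sequence. -/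
structure IsBandwidth (q : ℕ) (h : ℕ → ℝ) : Prop where
  pos : ∀ n, 0 < h n
  tendsto_zero : Tendsto h atTop (𝓝 0)
  tendsto_mul : Tendsto (fun n : ℕ => (n : ℝ) * h n ^ q) atTop atTop

/-- The regression model `Y = m(X) + σ(X) ε`: `X` has density `f` with respect to the surface
measure, `E[ε | X] = 0`, `E[ε² | X] = 1`, and the third and fourth absolute conditional moments of
`ε` given `X` are bounded random variables. -/
structure RegressionModel {q : ℕ} {Ω : Type*} [MeasurableSpace Ω] (μ : Measure Ω)
    (m σ f : Sph q → ℝ) (X : Ω → Sph q) (Y ε : Ω → ℝ) : Prop where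
  measurable_X : Measurable X
  measurable_Y : Measurable Y
  measurable_noise : Measurable ε
  density : μ.map X = (surfaceMeasure q).withDensity fun x => ENNReal.ofReal (f x)
  model : ∀ᵐ ω ∂μ, Y ω = m (X ω) + σ (X ω) * ε ω
  memLp_noise : MemLp ε 4 μ
  condMean : μ[ε | MeasurableSpace.comap X inferInstance] =ᵐ[μ] fun _ => 0
  condSq : μ[fun ω => ε ω ^ 2 | MeasurableSpace.comap X inferInstance] =ᵐ[μ] fun _ => 1
  condThird : ∃ C : ℝ, ∀ᵐ ω ∂μ,
    (μ[fun ω => |ε ω| ^ 3 | MeasurableSpace.comap X inferInstance]) ω ≤ C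
  condFourth : ∃ C : ℝ, ∀ᵐ ω ∂μ,
    (μ[fun ω => ε ω ^ 4 | MeasurableSpace.comap X inferInstance]) ω ≤ C

/-- The events `A n x` have probability tending to zero, uniformly in `x ∈ S`. -/
def UniformlyNegligible {Ω ι : Type*} [MeasurableSpace Ω] (μ : Measure Ω) (S : Set ι)
    (A : ℕ → ι → Set Ω) : Prop :=
  Tendsto (fun n => ⨆ x ∈ S, μ (A n x)) atTop (𝓝 0)

/-- `R n x = o_P(1)` uniformly in `x ∈ S`. -/
def UniformOP {Ω ι : Type*} [MeasurableSpace Ω] (μ : Measure Ω) (S : Set ι)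
    (R : ℕ → ι → Ω → ℝ) : Prop :=
  ∀ δ : ℝ, 0 < δ → UniformlyNegligible μ S fun n x => {ω | δ ≤ |R n x ω|}

end DirReg

end

/-!
Gnomonic coordinates at `x`, rescaled by `h`, turn the normal equations at `x` into averages over
the sample with weights `L(‖u‖² / 2) ψ(u)`, up to a vanishing perturbation. Such averages have
variance of order `(n h ^ q)⁻¹`, and by compactness of the sphere their means converge uniformly in
`x`. Hence the normalised matrix `𝒳ᵀ 𝒲 𝒳` converges to `f(x)` times the Gram matrix of the
regressors `1, u₁, …, u_q`, which is positive definite, and both the local estimator and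
`∑ᵢ L*_h(x, Xᵢ) Yᵢ` converge to `m(x)`.

This does not make the individual ratios of the weights `Wᵢ / L*_h(x, Xᵢ)` uniformly close to `1`
when `p = 1`, because observations far from `x` have rescaled coordinates of order `1 / h`. Instead
the difference `D` of the two estimators is distributed over the terms of the sum in proportion to
`|L*_h(x, Xᵢ) Yᵢ|`, that is, `rᵢ = sign(Yᵢ) D / ∑ⱼ L*_h(x, Xⱼ) |Yⱼ|`. The denominator stays away
from `0`, also at the zeros of `m`, because the noise does not vanish there.
-/

noncomputable section

namespace DirReg

open scoped Matrix ENNReal NNReal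

theorem lintegral_polar {E : Type*} [NormedAddCommGroup E] [NormedSpace ℝ E]
    [FiniteDimensional ℝ E] [Nontrivial E] [MeasurableSpace E] [BorelSpace E] (μ : Measure E)
    [μ.IsAddHaarMeasure] {F : E → ℝ≥0∞} (hF : Measurable F) :
    ∫⁻ y, F y ∂μ = ∫⁻ θ, ∫⁻ r in Set.Ioi (0 : ℝ),
      F (r • (θ : E)) * ENNReal.ofReal (r ^ (Module.finrank ℝ E - 1))
        ∂(volume : Measure ℝ) ∂μ.toSphere := by
  have hcont : Measurable fun p : Metric.sphere (0 : E) 1 × Set.Ioi (0 : ℝ) =>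
      F ((p.2 : ℝ) • (p.1 : E)) := hF.comp (by fun_prop)
  calc ∫⁻ y, F y ∂μ = ∫⁻ y : ({0}ᶜ : Set E), F y ∂μ.comap (↑) := by
        rw [lintegral_subtype_comap (measurableSet_singleton _).compl, restrict_compl_singleton]
    _ = ∫⁻ p, F ((p.2 : ℝ) • (p.1 : E))
          ∂(μ.toSphere.prod (Measure.volumeIoiPow (Module.finrank ℝ E - 1))) := by
        rw [← μ.measurePreserving_homeomorphUnitSphereProd.lintegral_comp hcont]
        refine lintegral_congr fun y => ?_
        have hy : ‖(y : E)‖ ≠ 0 := norm_ne_zero_iff.mpr y.2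
        simp [smul_smul, hy]
    _ = _ := by
        rw [lintegral_prod _ hcont.aemeasurable]
        refine lintegral_congr fun θ => ?_
        have hray : Measurable fun r : Set.Ioi (0 : ℝ) => F ((r : ℝ) • (θ : E)) :=
          hcont.comp measurable_prodMk_left
        rw [Measure.volumeIoiPow, lintegral_withDensity_eq_lintegral_mul _ (by fun_prop) hray,
          ← lintegral_subtype_comap measurableSet_Ioi]
        exact lintegral_congr fun r => mul_comm _ _

theorem setLIntegral_Ioo_zero_pow (q : ℕ) {a : ℝ} (ha : 0 ≤ a) :
    ∫⁻ r in Set.Ioo 0 a, ENNReal.ofReal (r ^ q) = ENNReal.ofReal (a ^ (q + 1) / (q + 1)) := by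
  rw [Measure.restrict_congr_set Ioo_ae_eq_Ioc,
    ← ofReal_integral_eq_lintegral_ofReal (intervalIntegral.intervalIntegrable_pow _).1,
    ← intervalIntegral.integral_of_le ha]
  · simp
  · exact (ae_restrict_iff' measurableSet_Ioc).mpr (ae_of_all _ fun r hr => pow_nonneg hr.1.le _)

theorem lintegral_eq_pow_finrank_mul_lintegral_comp_smul {E : Type*} [NormedAddCommGroup E]
    [NormedSpace ℝ E] [FiniteDimensional ℝ E] [MeasurableSpace E] [BorelSpace E] (μ : Measure E)
    [μ.IsAddHaarMeasure] {G : E → ℝ≥0∞} (hG : Measurable G) {s : ℝ} (hs : 0 < s) :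
    ∫⁻ v, G v ∂μ = ENNReal.ofReal (s ^ Module.finrank ℝ E) * ∫⁻ u, G (s • u) ∂μ := by
  rw [← lintegral_map hG (measurable_const_smul s), Measure.map_addHaar_smul μ hs.ne',
    lintegral_smul_measure, smul_eq_mul, ← mul_assoc, ← ENNReal.ofReal_mul (by positivity),
    abs_of_pos (by positivity), mul_inv_cancel₀ (by positivity), ENNReal.ofReal_one, one_mul]

section Frame

variable {q : ℕ}

/-- The linear map sending `v` to the tangent vector `B v`. -/
def tangentVec (B : Matrix (Fin (q + 1)) (Fin q) ℝ) : EuclideanSpace ℝ (Fin q) →L[ℝ] Amb q :=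
  (Matrix.toEuclideanLin B).toContinuousLinearMap

/-- The linear map sending `y` to its coordinates `Bᵀ y` along the columns of `B`. -/
def tangentCoord (B : Matrix (Fin (q + 1)) (Fin q) ℝ) : Amb q →L[ℝ] EuclideanSpace ℝ (Fin q) :=
  (Matrix.toEuclideanLin Bᵀ).toContinuousLinearMap

theorem tangentVec_eq_sum (B : Matrix (Fin (q + 1)) (Fin q) ℝ) (v : EuclideanSpace ℝ (Fin q)) :
    tangentVec B v = ∑ j, v j • WithLp.toLp 2 (fun k => B k j) := by
  ext k
  simp [tangentVec, Matrix.toLpLin_apply, Matrix.mulVec, dotProduct, mul_comm]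

theorem tangentCoord_apply (B : Matrix (Fin (q + 1)) (Fin q) ℝ) (y : Amb q) (j : Fin q) :
    tangentCoord B y j = inner ℝ (WithLp.toLp 2 (fun k => B k j)) y := by
  simp [tangentCoord, Matrix.toLpLin_apply, Matrix.mulVec, dotProduct, PiLp.inner_apply, mul_comm]

namespace IsProjectionMatrix

variable {x : Sph q} {B : Matrix (Fin (q + 1)) (Fin q) ℝ} (hB : IsProjectionMatrix x B)

/-- The orthonormal basis consisting of `x` and the columns of `B`. -/
def basis : OrthonormalBasis (Fin (q + 1)) ℝ (Amb q) :=
  (basisOfOrthonormalOfCardEqFinrank hB (by simp)).toOrthonormalBasis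
    ((congrArg (Orthonormal ℝ) (coe_basisOfOrthonormalOfCardEqFinrank hB (by simp))).mpr hB)

theorem coe_basis :
    ⇑hB.basis = Fin.cons (x : Amb q) (fun j => WithLp.toLp 2 (fun k => B k j)) :=
  (Module.Basis.coe_toOrthonormalBasis _ _).trans
    (coe_basisOfOrthonormalOfCardEqFinrank hB (by simp))

theorem basis_zero : hB.basis 0 = (x : Amb q) := by
  rw [hB.coe_basis]; rfl

theorem basis_succ (j : Fin q) : hB.basis j.succ = WithLp.toLp 2 (fun k => B k j) := by
  rw [hB.coe_basis]; rfl

theorem repr_symm_cons (s : ℝ) (v : EuclideanSpace ℝ (Fin q)) :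
    hB.basis.repr.symm (WithLp.toLp 2 (Fin.cons s (WithLp.ofLp v) : Fin (q + 1) → ℝ)) =
      s • (x : Amb q) + tangentVec B v := by
  rw [← OrthonormalBasis.sum_repr_symm]
  simp [Fin.sum_univ_succ, tangentVec_eq_sum, hB.basis_zero, hB.basis_succ]

include hB

theorem norm_smul_add_tangentVec (s : ℝ) (v : EuclideanSpace ℝ (Fin q)) :
    ‖s • (x : Amb q) + tangentVec B v‖ = √(s ^ 2 + ‖v‖ ^ 2) := by
  rw [← hB.repr_symm_cons, LinearIsometryEquiv.norm_map, EuclideanSpace.norm_eq,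
    EuclideanSpace.norm_sq_eq]
  simp [Fin.sum_univ_succ]

theorem inner_smul_add_tangentVec (s : ℝ) (v : EuclideanSpace ℝ (Fin q)) :
    inner ℝ (x : Amb q) (s • (x : Amb q) + tangentVec B v) = s := by
  rw [← hB.repr_symm_cons, ← hB.basis_zero, ← OrthonormalBasis.repr_apply_apply]
  simp

theorem tangentCoord_smul_add_tangentVec (s : ℝ) (v : EuclideanSpace ℝ (Fin q)) :
    tangentCoord B (s • (x : Amb q) + tangentVec B v) = v := by
  ext j
  rw [tangentCoord_apply, ← hB.repr_symm_cons, ← hB.basis_succ,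
    ← OrthonormalBasis.repr_apply_apply]
  simp

theorem tangentCoord_self : tangentCoord B (x : Amb q) = 0 := by
  simpa using hB.tangentCoord_smul_add_tangentVec 1 0

theorem norm_sq_eq_inner_sq_add_norm_tangentCoord_sq (y : Amb q) :
    ‖y‖ ^ 2 = inner ℝ (x : Amb q) y ^ 2 + ‖tangentCoord B y‖ ^ 2 := by
  rw [← hB.basis.repr.norm_map y, EuclideanSpace.norm_sq_eq, EuclideanSpace.norm_sq_eq,
    Fin.sum_univ_succ]
  simp [tangentCoord_apply, OrthonormalBasis.repr_apply_apply, hB.basis_zero, hB.basis_succ]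

theorem measurePreserving_smul_add_tangentVec :
    MeasurePreserving (fun p : ℝ × EuclideanSpace ℝ (Fin q) =>
      p.1 • (x : Amb q) + tangentVec B p.2) (volume.prod volume) volume := by
  have hprod : MeasurePreserving (Prod.map id (WithLp.ofLp : EuclideanSpace ℝ (Fin q) → _))
      (volume.prod volume) ((volume : Measure ℝ).prod volume) :=
    (MeasurePreserving.id _).prod (PiLp.volume_preserving_ofLp (Fin q))
  have hcons := (volume_preserving_piFinSuccAbove (fun _ : Fin (q + 1) => ℝ) 0).symm
  have hcomp := hB.basis.repr.symm.measurePreserving.comp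
    ((PiLp.volume_preserving_toLp (Fin (q + 1))).comp (hcons.comp hprod))
  refine (congrArg (MeasurePreserving · (volume.prod volume) volume) ?_).mp hcomp
  funext p
  rw [← hB.repr_symm_cons]
  refine congrArg hB.basis.repr.symm (congrArg (WithLp.toLp 2) (funext fun i => ?_))
  refine Fin.cases ?_ (fun j => ?_) i <;> simp [MeasurableEquiv.piFinSuccAbove]

end IsProjectionMatrix

end Frame

section Gnomonic

variable {q : ℕ}

/-- The radial projection of `y` to the unit sphere, with the junk value `x` at the origin. -/
def sphereProj (x : Sph q) (y : Amb q) : Sph q :=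
  ⟨if y = 0 then (x : Amb q) else NormedSpace.normalize y, by
    split_ifs with h
    · exact x.2
    · simpa using h⟩

theorem coe_sphereProj (x : Sph q) {y : Amb q} (hy : y ≠ 0) :
    (sphereProj x y : Amb q) = NormedSpace.normalize y := by
  simp [sphereProj, hy]

theorem measurable_sphereProj (x : Sph q) : Measurable (sphereProj x) := by
  refine Measurable.subtype_mk ?_
  unfold NormedSpace.normalize
  exact Measurable.ite (measurableSet_singleton _) measurable_const (by fun_prop)

theorem sphereProj_smul (x : Sph q) {s : ℝ} (hs : 0 < s) {y : Amb q} (hy : y ≠ 0) :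
    sphereProj x (s • y) = sphereProj x y := by
  refine Subtype.ext ?_
  rw [coe_sphereProj x hy, coe_sphereProj x (smul_ne_zero hs.ne' hy),
    NormedSpace.normalize_smul_of_pos hs]

theorem sphereProj_coe (x θ : Sph q) : sphereProj x (θ : Amb q) = θ := by
  refine Subtype.ext ?_
  rw [coe_sphereProj x (ne_zero_of_mem_unit_sphere θ)]
  simp [NormedSpace.normalize]

/-- The open hemisphere centred at `x`. -/
def hemisphere (x : Sph q) : Set (Sph q) := {θ | 0 < inner ℝ (x : Amb q) (θ : Amb q)}

/-- The open slab between the hyperplane orthogonal to `x` and the tangent hyperplane at `x`. Its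
volume can be computed in polar coordinates and in coordinates adapted to the tangent space. -/
def slab (x : Sph q) : Set (Amb q) := {y | inner ℝ (x : Amb q) y ∈ Set.Ioo 0 1}

theorem measurableSet_hemisphere (x : Sph q) : MeasurableSet (hemisphere x) :=
  measurableSet_lt measurable_const (by fun_prop)

theorem measurableSet_slab (x : Sph q) : MeasurableSet (slab x) :=
  measurableSet_Ioo.preimage (by fun_prop)

theorem lintegral_slab_polar (x : Sph q) {H : Sph q → ℝ≥0∞} (hH : Measurable H) :
    ∫⁻ y in slab x, H (sphereProj x y) =
      ∫⁻ θ in hemisphere x,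
        H θ * ENNReal.ofReal ((inner ℝ (x : Amb q) (θ : Amb q))⁻¹ ^ (q + 1) / (q + 1))
        ∂surfaceMeasure q := by
  have hK : Measurable ((slab x).indicator fun y => H (sphereProj x y)) :=
    (hH.comp (measurable_sphereProj x)).indicator (measurableSet_slab x)
  rw [← lintegral_indicator (measurableSet_slab x), lintegral_polar _ hK,
    ← lintegral_indicator (measurableSet_hemisphere x)]
  refine lintegral_congr fun θ => ?_
  set a : ℝ := inner ℝ (x : Amb q) (θ : Amb q)
  have mem_slab (r : ℝ) : r • (θ : Amb q) ∈ slab x ↔ r * a ∈ Set.Ioo 0 1 := by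
    simp [slab, inner_smul_right, a]
  by_cases ha : 0 < a
  · have hray : ∀ r ∈ Set.Ioi (0 : ℝ),
        (slab x).indicator (fun y => H (sphereProj x y)) (r • (θ : Amb q)) *
            ENNReal.ofReal (r ^ (Module.finrank ℝ (Amb q) - 1)) =
          (Set.Iio a⁻¹).indicator (fun r => H θ * ENNReal.ofReal (r ^ q)) r := by
      intro r (hr : 0 < r)
      have hmem : r • (θ : Amb q) ∈ slab x ↔ r ∈ Set.Iio a⁻¹ := by
        rw [mem_slab, Set.mem_Ioo, Set.mem_Iio, ← one_div, lt_div_iff₀ ha]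
        exact and_iff_right (by positivity)
      by_cases h : r ∈ Set.Iio a⁻¹
      · rw [Set.indicator_of_mem (hmem.mpr h), Set.indicator_of_mem h,
          sphereProj_smul x hr (ne_zero_of_mem_unit_sphere θ), sphereProj_coe]
        simp
      · rw [Set.indicator_of_notMem (hmem.not.mpr h), Set.indicator_of_notMem h, zero_mul]
    rw [Set.indicator_of_mem (by exact ha), setLIntegral_congr_fun measurableSet_Ioi hray,
      lintegral_indicator measurableSet_Iio, Measure.restrict_restrict measurableSet_Iio,
      Set.inter_comm, Set.Ioi_inter_Iio, lintegral_const_mul _ (by fun_prop),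
      setLIntegral_Ioo_zero_pow q (by positivity)]
  · rw [Set.indicator_of_notMem (by exact ha)]
    refine (setLIntegral_congr_fun measurableSet_Ioi fun r (hr : 0 < r) => ?_).trans
      lintegral_zero
    rw [Set.indicator_of_notMem, zero_mul]
    exact fun h => ha (pos_of_mul_pos_right ((mem_slab r).mp h).1 hr.le)

/-- The inverse of the central projection of the open hemisphere at `x` to the tangent space at
`x`, in the coordinates given by `B`. -/
def gnomonic (x : Sph q) (B : Matrix (Fin (q + 1)) (Fin q) ℝ) (v : EuclideanSpace ℝ (Fin q)) :
    Sph q :=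
  sphereProj x ((1 : ℝ) • (x : Amb q) + tangentVec B v)

theorem measurable_gnomonic (x : Sph q) (B : Matrix (Fin (q + 1)) (Fin q) ℝ) :
    Measurable (gnomonic x B) :=
  (measurable_sphereProj x).comp (by fun_prop)

namespace IsProjectionMatrix

variable {x : Sph q} {B : Matrix (Fin (q + 1)) (Fin q) ℝ} (hB : IsProjectionMatrix x B)

include hB

theorem smul_add_tangentVec_ne_zero {s : ℝ} (hs : s ≠ 0) (v : EuclideanSpace ℝ (Fin q)) :
    s • (x : Amb q) + tangentVec B v ≠ 0 := by
  rw [← norm_ne_zero_iff, hB.norm_smul_add_tangentVec]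
  positivity

theorem sphereProj_smul_add_tangentVec {s : ℝ} (hs : 0 < s) (u : EuclideanSpace ℝ (Fin q)) :
    sphereProj x (s • (x : Amb q) + tangentVec B (s • u)) = gnomonic x B u := by
  rw [gnomonic, ← sphereProj_smul x hs (hB.smul_add_tangentVec_ne_zero one_ne_zero u), smul_add,
    smul_smul, mul_one, map_smul]

theorem coe_gnomonic (v : EuclideanSpace ℝ (Fin q)) :
    (gnomonic x B v : Amb q) =
      (√(1 + ‖v‖ ^ 2))⁻¹ • ((1 : ℝ) • (x : Amb q) + tangentVec B v) := by
  rw [gnomonic, coe_sphereProj x (hB.smul_add_tangentVec_ne_zero one_ne_zero v),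
    NormedSpace.normalize, hB.norm_smul_add_tangentVec, one_pow]

theorem inner_gnomonic (v : EuclideanSpace ℝ (Fin q)) :
    inner ℝ (x : Amb q) (gnomonic x B v : Amb q) = (√(1 + ‖v‖ ^ 2))⁻¹ := by
  rw [hB.coe_gnomonic, inner_smul_right, hB.inner_smul_add_tangentVec, mul_one]

theorem tangentCoord_gnomonic (v : EuclideanSpace ℝ (Fin q)) :
    tangentCoord B (gnomonic x B v : Amb q) = (√(1 + ‖v‖ ^ 2))⁻¹ • v := by
  rw [hB.coe_gnomonic, map_smul, hB.tangentCoord_smul_add_tangentVec]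

theorem lintegral_slab_gnomonic {H : Sph q → ℝ≥0∞} (hH : Measurable H) :
    ∫⁻ y in slab x, H (sphereProj x y) =
      ENNReal.ofReal (1 / (q + 1)) * ∫⁻ v, H (gnomonic x B v) := by
  have hK : Measurable ((slab x).indicator fun y => H (sphereProj x y)) :=
    (hH.comp (measurable_sphereProj x)).indicator (measurableSet_slab x)
  have hslice (s : ℝ) : ∫⁻ v, (slab x).indicator (fun y => H (sphereProj x y))
        (s • (x : Amb q) + tangentVec B v) =
      (Set.Ioo 0 1).indicator
        (fun s => ENNReal.ofReal (s ^ q) * ∫⁻ u, H (gnomonic x B u)) s := by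
    have mem_slab (v : EuclideanSpace ℝ (Fin q)) :
        s • (x : Amb q) + tangentVec B v ∈ slab x ↔ s ∈ Set.Ioo 0 1 := by
      rw [slab, Set.mem_ofPred_eq, hB.inner_smul_add_tangentVec]
    by_cases hs : s ∈ Set.Ioo 0 1
    · rw [Set.indicator_of_mem hs, lintegral_eq_pow_finrank_mul_lintegral_comp_smul volume
        (by fun_prop) hs.1, finrank_euclideanSpace_fin]
      simp only [Set.indicator_of_mem ((mem_slab _).mpr hs),
        hB.sphereProj_smul_add_tangentVec hs.1]
    · simp only [Set.indicator_of_notMem hs, Set.indicator_of_notMem ((mem_slab _).not.mpr hs),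
        lintegral_zero]
  rw [← lintegral_indicator (measurableSet_slab x),
    ← hB.measurePreserving_smul_add_tangentVec.lintegral_comp hK,
    lintegral_prod _ (by fun_prop), lintegral_congr hslice, lintegral_indicator measurableSet_Ioo,
    lintegral_mul_const _ (by fun_prop), setLIntegral_Ioo_zero_pow q zero_le_one, one_pow]

theorem lintegral_hemisphere {F : Sph q → ℝ≥0∞} (hF : Measurable F) :
    ∫⁻ θ in hemisphere x, F θ ∂surfaceMeasure q =
      ∫⁻ v, F (gnomonic x B v) * ENNReal.ofReal ((√(1 + ‖v‖ ^ 2))⁻¹ ^ (q + 1)) := by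
  set c : ℝ≥0∞ := ENNReal.ofReal (1 / (q + 1))
  have hc : c ≠ 0 := by simpa [c] using by positivity
  have hH : Measurable fun θ : Sph q =>
      F θ * ENNReal.ofReal ((inner ℝ (x : Amb q) (θ : Amb q)) ^ (q + 1)) := by fun_prop
  have hslab := (lintegral_slab_polar x hH).symm.trans (hB.lintegral_slab_gnomonic hH)
  simp only [hB.inner_gnomonic] at hslab
  refine (ENNReal.mul_right_inj hc ENNReal.ofReal_ne_top).mp (Eq.trans ?_ hslab)
  rw [← lintegral_const_mul _ hF]
  refine setLIntegral_congr_fun (measurableSet_hemisphere x) fun θ hθ => ?_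
  have hpos : 0 < inner ℝ (x : Amb q) (θ : Amb q) := hθ
  rw [mul_assoc, ← ENNReal.ofReal_mul (by positivity), ← mul_div_assoc, ← mul_pow,
    mul_inv_cancel₀ hpos.ne', one_pow, mul_comm]

theorem restrict_hemisphere :
    (surfaceMeasure q).restrict (hemisphere x) =
      (volume.withDensity fun v => ENNReal.ofReal ((√(1 + ‖v‖ ^ 2))⁻¹ ^ (q + 1))).map
        (gnomonic x B) := by
  refine Measure.ext_of_lintegral _ fun F hF => ?_
  have hFg : Measurable fun v => F (gnomonic x B v) := hF.comp (measurable_gnomonic x B)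
  rw [hB.lintegral_hemisphere hF, lintegral_map hF (measurable_gnomonic x B),
    lintegral_withDensity_eq_lintegral_mul _ (by fun_prop) hFg]
  exact lintegral_congr fun v => mul_comm _ _

theorem integral_hemisphere {F : Sph q → ℝ} (hF : Measurable F) :
    ∫ θ in hemisphere x, F θ ∂surfaceMeasure q =
      ∫ v, (√(1 + ‖v‖ ^ 2))⁻¹ ^ (q + 1) * F (gnomonic x B v) := by
  rw [hB.restrict_hemisphere, integral_map (measurable_gnomonic x B).aemeasurable
    hF.aestronglyMeasurable, integral_withDensity_eq_integral_toReal_smul (by fun_prop)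
      (ae_of_all _ fun _ => ENNReal.ofReal_lt_top)]
  refine integral_congr_ae (ae_of_all _ fun v => ?_)
  simp only [smul_eq_mul]
  rw [ENNReal.toReal_ofReal (by positivity)]

end IsProjectionMatrix

end Gnomonic

section ModerateGrowth

/-- Continuous functions growing more slowly than every Gaussian `exp (β ‖u‖ ^ 2)`. They are the
test functions that can be integrated against a directional kernel in rescaled coordinates. -/
structure ModerateGrowth {E : Type*} [NormedAddCommGroup E] (ψ : E → ℝ) : Prop where
  continuous : Continuous ψ
  bound : ∀ β : ℝ, 0 < β → ∃ C : ℝ, 0 ≤ C ∧ ∀ u, |ψ u| ≤ C * Real.exp (β * ‖u‖ ^ 2)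

variable {E : Type*} [NormedAddCommGroup E]

theorem ModerateGrowth.mul {ψ φ : E → ℝ} (hψ : ModerateGrowth ψ) (hφ : ModerateGrowth φ) :
    ModerateGrowth fun u => ψ u * φ u where
  continuous := hψ.continuous.mul hφ.continuous
  bound β hβ := by
    obtain ⟨C, hC, hψC⟩ := hψ.bound (β / 2) (by positivity)
    obtain ⟨D, hD, hφD⟩ := hφ.bound (β / 2) (by positivity)
    refine ⟨C * D, by positivity, fun u => ?_⟩
    calc |ψ u * φ u| ≤
          (C * Real.exp (β / 2 * ‖u‖ ^ 2)) * (D * Real.exp (β / 2 * ‖u‖ ^ 2)) := by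
          rw [abs_mul]
          exact mul_le_mul (hψC u) (hφD u) (abs_nonneg _) (by positivity)
      _ = C * D * Real.exp (β * ‖u‖ ^ 2) := by
          rw [mul_mul_mul_comm, ← Real.exp_add]
          ring_nf

theorem ModerateGrowth.sum {ι : Type*} [Fintype ι] {ψ : ι → E → ℝ}
    (hψ : ∀ i, ModerateGrowth (ψ i)) : ModerateGrowth fun u => ∑ i, ψ i u where
  continuous := continuous_finsetSum _ fun i _ => (hψ i).continuous
  bound β hβ := by
    choose C hC hle using fun i => (hψ i).bound β hβ
    refine ⟨∑ i, C i, Finset.sum_nonneg fun i _ => hC i, fun u => ?_⟩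
    rw [Finset.sum_mul]
    exact (Finset.abs_sum_le_sum_abs _ _).trans (Finset.sum_le_sum fun i _ => hle i u)

theorem ModerateGrowth.const (c : ℝ) : ModerateGrowth fun _ : E => c where
  continuous := continuous_const
  bound β hβ := ⟨|c|, abs_nonneg _, fun u =>
    le_mul_of_one_le_right (abs_nonneg _) (Real.one_le_exp (by positivity))⟩

theorem ModerateGrowth.of_clm [NormedSpace ℝ E] (φ : E →L[ℝ] ℝ) : ModerateGrowth φ where
  continuous := φ.continuous
  bound β hβ := by
    refine ⟨‖φ‖ / (2 * √β), by positivity, fun u => ?_⟩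
    have hexp : 2 * √β * ‖u‖ ≤ Real.exp (β * ‖u‖ ^ 2) := by
      have hsqrt : √β ^ 2 = β := Real.sq_sqrt hβ.le
      calc 2 * √β * ‖u‖ ≤ β * ‖u‖ ^ 2 + 1 := by nlinarith [sq_nonneg (√β * ‖u‖ - 1)]
        _ ≤ _ := Real.add_one_le_exp _
    calc |φ u| ≤ ‖φ‖ * ‖u‖ := φ.le_opNorm u
      _ = ‖φ‖ / (2 * √β) * (2 * √β * ‖u‖) := by field_simp
      _ ≤ _ := by gcongr

end ModerateGrowth

theorem integrable_exp_neg_mul_norm_sq {V : Type*} [NormedAddCommGroup V] [InnerProductSpace ℝ V]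
    [FiniteDimensional ℝ V] [MeasurableSpace V] [BorelSpace V] {b : ℝ} (hb : 0 < b) :
    Integrable fun u : V => Real.exp (-b * ‖u‖ ^ 2) := by
  have h := (GaussianFourier.integrable_cexp_neg_mul_sq_norm_add (V := V) (b := (b : ℂ))
    (by simpa using hb) 0 0).norm
  refine h.congr (ae_of_all _ fun u => ?_)
  simp only [Complex.norm_exp]
  congr 1
  norm_cast
  simp

theorem tendsto_inv_pow_mul_exp_neg_div_sq (q : ℕ) {a : ℝ} (ha : 0 < a) :
    Tendsto (fun h : ℝ => (h ^ q)⁻¹ * Real.exp (-a / h ^ 2)) (𝓝[>] 0) (𝓝 0) := by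
  have hlim := (tendsto_rpow_mul_exp_neg_mul_atTop_nhds_zero (q : ℝ) a ha).comp
    tendsto_inv_nhdsGT_zero
  refine squeeze_zero' ?_ ?_ hlim
  · filter_upwards [self_mem_nhdsWithin] with h (hh : 0 < h)
    positivity
  · filter_upwards [self_mem_nhdsWithin, Ioo_mem_nhdsGT one_pos] with h (hh : 0 < h) h1
    simp only [Function.comp_apply, Real.rpow_natCast, inv_pow]
    have hinv : h⁻¹ ≤ (h ^ 2)⁻¹ := by
      gcongr
      exact pow_le_of_le_one hh.le h1.2.le two_ne_zero
    gcongr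
    rw [neg_div, neg_mul, neg_le_neg_iff, div_eq_mul_inv]
    gcongr

theorem tendstoUniformly_of_forall_tendsto_dist {ι α β : Type*} [PseudoMetricSpace β]
    {F : ι → α → β} {f : α → β} {l : Filter ι}
    (h : ∀ x : ι → α, Tendsto (fun i => dist (f (x i)) (F i (x i))) l (𝓝 0)) :
    TendstoUniformly F f l := by
  rw [Metric.tendstoUniformly_iff]
  intro ε hε
  rcases isEmpty_or_nonempty α with _ | _
  · exact Eventually.of_forall fun _ => isEmptyElim
  -- pick the worst offender for each index
  have hworst : ∀ i, ∃ y, dist (f y) (F i y) < ε → ∀ z, dist (f z) (F i z) < ε := fun i =>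
    (em (∀ z, dist (f z) (F i z) < ε)).elim (fun hz => ⟨Classical.arbitrary α, fun _ => hz⟩)
      fun hz => (not_forall.mp hz).imp fun _ hy hy' => absurd hy' hy
  choose x hx using hworst
  filter_upwards [(h x).eventually_lt_const hε] with i hi
  exact hx i hi

section Kernel

variable {q : ℕ} {L : ℝ → ℝ}

instance : IsFiniteMeasure (surfaceMeasure q) := by
  unfold surfaceMeasure; infer_instance

theorem one_sub_inner_nonneg (x y : Sph q) : 0 ≤ 1 - inner ℝ (x : Amb q) (y : Amb q) :=
  sub_nonneg.mpr <| real_inner_le_one_of_norm_eq_one (norm_eq_of_mem_sphere x)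
    (norm_eq_of_mem_sphere y)

theorem exists_abs_le_of_continuous {α : Type*} [TopologicalSpace α] [CompactSpace α] {G : α → ℝ}
    (hG : Continuous G) : ∃ D : ℝ, 0 ≤ D ∧ ∀ y, |G y| ≤ D := by
  obtain ⟨D, hD⟩ := isCompact_univ.exists_bound_of_continuousOn hG.continuousOn
  exact ⟨max D 0, le_max_right _ _, fun y => (hD y trivial).trans (le_max_left _ _)⟩

namespace IsDirectionalKernel

theorem continuous_comp (hL : IsDirectionalKernel L) {α : Type*} [TopologicalSpace α]
    {g : α → ℝ} (hg : Continuous g) (h0 : ∀ a, 0 ≤ g a) : Continuous fun a => L (g a) :=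
  hL.continuousOn.comp_continuous hg h0

theorem continuous_sphere (hL : IsDirectionalKernel L) (h : ℝ) (x : Sph q) :
    Continuous fun y : Sph q => L ((1 - inner ℝ (x : Amb q) (y : Amb q)) / h ^ 2) :=
  hL.continuous_comp (by fun_prop) fun y => div_nonneg (one_sub_inner_nonneg x y) (sq_nonneg h)

theorem sq (hL : IsDirectionalKernel L) : IsDirectionalKernel fun r => L r ^ 2 where
  continuousOn := hL.continuousOn.pow 2
  nonneg r _ := sq_nonneg _
  nontrivial := hL.nontrivial.imp fun _ h => ⟨h.1, pow_ne_zero 2 h.2⟩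
  bounded := hL.bounded.imp' (· ^ 2) fun _ hK r hr => pow_le_pow_left₀ (hL.nonneg r hr) (hK r hr) 2
  decay := by
    obtain ⟨M, α, hM, hα, hdecay⟩ := hL.decay
    refine ⟨M ^ 2, 2 * α, by positivity, by positivity, fun r hr => ?_⟩
    refine (pow_le_pow_left₀ (hL.nonneg r hr) (hdecay r hr) 2).trans (le_of_eq ?_)
    rw [mul_pow, ← Real.exp_nat_mul]
    push_cast
    ring_nf

theorem exists_abs_mul_le {E : Type*} [NormedAddCommGroup E] (hL : IsDirectionalKernel L)
    {ψ : E → ℝ} (hψ : ModerateGrowth ψ) :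
    ∃ C β : ℝ, 0 ≤ C ∧ 0 < β ∧
      ∀ r w, 0 ≤ r → ‖w‖ ^ 2 ≤ 2 * r → |L r * ψ w| ≤ C * Real.exp (-β * r) := by
  obtain ⟨M, α, hM, hα, hdecay⟩ := hL.decay
  obtain ⟨C, hC, hψC⟩ := hψ.bound (α / 4) (by positivity)
  refine ⟨M * C, α / 2, by positivity, by positivity, fun r w hr hw => ?_⟩
  have hψw : |ψ w| ≤ C * Real.exp (α / 2 * r) :=
    (hψC w).trans (mul_le_mul_of_nonneg_left (Real.exp_le_exp.mpr (by nlinarith)) hC)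
  calc |L r * ψ w| ≤ (M * Real.exp (-α * r)) * (C * Real.exp (α / 2 * r)) := by
        rw [abs_mul, abs_of_nonneg (hL.nonneg r hr)]
        exact mul_le_mul (hdecay r hr) hψw (abs_nonneg _) (by positivity)
    _ = M * C * Real.exp (-(α / 2) * r) := by
        rw [mul_mul_mul_comm, ← Real.exp_add]
        ring_nf

end IsDirectionalKernel

theorem ModerateGrowth.integrable_kernel {V : Type*} [NormedAddCommGroup V]
    [InnerProductSpace ℝ V] [FiniteDimensional ℝ V] [MeasurableSpace V] [BorelSpace V]
    (hL : IsDirectionalKernel L) {ψ : V → ℝ} (hψ : ModerateGrowth ψ) :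
    Integrable fun u => L (‖u‖ ^ 2 / 2) * ψ u := by
  obtain ⟨C, β, -, hβ, hle⟩ := hL.exists_abs_mul_le hψ
  refine ((integrable_exp_neg_mul_norm_sq (V := V) (half_pos hβ)).const_mul C).mono' ?_
    (ae_of_all _ fun u => (hle _ u (by positivity) (by linarith)).trans_eq (by ring_nf))
  exact ((hL.continuous_comp (by fun_prop) fun u => by positivity).mul
    hψ.continuous).aestronglyMeasurable

/-- The kernel `L((1 - xᵀy) / h²)` multiplied by a function `ψ` of the rescaled tangent coordinates
`Bᵀ y / h`. -/
def localKernel (L : ℝ → ℝ) (ψ : EuclideanSpace ℝ (Fin q) → ℝ) (h : ℝ) (x : Sph q)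
    (B : Matrix (Fin (q + 1)) (Fin q) ℝ) (y : Sph q) : ℝ :=
  L ((1 - inner ℝ (x : Amb q) (y : Amb q)) / h ^ 2) * ψ (h⁻¹ • tangentCoord B (y : Amb q))

/-- The integral of a function `G` on the sphere against a local kernel. -/
def localIntegral (L : ℝ → ℝ) (ψ : EuclideanSpace ℝ (Fin q) → ℝ) (G : Sph q → ℝ) (h : ℝ)
    (x : Sph q) (B : Matrix (Fin (q + 1)) (Fin q) ℝ) : ℝ :=
  ∫ y, localKernel L ψ h x B y * G y ∂surfaceMeasure q

/-- The limit of the normalised local integrals of the constant function `1`: in gnomonic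
coordinates `(1 - xᵀy) / h²` becomes `‖u‖² / 2`. -/
def kernelMoment {V : Type*} [NormedAddCommGroup V] [MeasureSpace V] (L : ℝ → ℝ)
    (ψ : V → ℝ) : ℝ :=
  ∫ u : V, L (‖u‖ ^ 2 / 2) * ψ u

variable {ψ : EuclideanSpace ℝ (Fin q) → ℝ} {G : Sph q → ℝ}

theorem continuous_localKernel (hL : IsDirectionalKernel L) (hψ : Continuous ψ) (h : ℝ)
    (x : Sph q) (B : Matrix (Fin (q + 1)) (Fin q) ℝ) : Continuous (localKernel L ψ h x B) :=
  (hL.continuous_sphere h x).mul (hψ.comp (by fun_prop))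

theorem exists_abs_localKernel_le (hL : IsDirectionalKernel L) (hψ : ModerateGrowth ψ) :
    ∃ C β : ℝ, 0 ≤ C ∧ 0 < β ∧ ∀ h x B y, IsProjectionMatrix x B →
      |localKernel L ψ h x B y| ≤
        C * Real.exp (-β * ((1 - inner ℝ (x : Amb q) (y : Amb q)) / h ^ 2)) := by
  obtain ⟨C, β, hC, hβ, hle⟩ := hL.exists_abs_mul_le hψ
  refine ⟨C, β, hC, hβ, fun h x B y hB => ?_⟩
  have hxy := one_sub_inner_nonneg x y
  refine hle _ _ (by positivity) ?_
  have hnorm := hB.norm_sq_eq_inner_sq_add_norm_tangentCoord_sq (y : Amb q)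
  rw [norm_eq_of_mem_sphere] at hnorm
  rw [norm_smul, mul_pow, norm_inv, Real.norm_eq_abs, inv_pow, sq_abs, ← mul_div_assoc,
    div_eq_inv_mul]
  gcongr
  nlinarith [sq_nonneg (1 - inner ℝ (x : Amb q) (y : Amb q))]

/-- The spherical cap of angular radius `π / 3` at `x`. -/
def cap (x : Sph q) : Set (Sph q) := {y | 1 / 2 < inner ℝ (x : Amb q) (y : Amb q)}

theorem measurableSet_cap (x : Sph q) : MeasurableSet (cap x) :=
  measurableSet_lt measurable_const (by fun_prop)

theorem cap_subset_hemisphere (x : Sph q) : cap x ⊆ hemisphere x := by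
  intro y (hy : (1 : ℝ) / 2 < inner ℝ (x : Amb q) (y : Amb q))
  exact (one_half_pos.trans hy : (0 : ℝ) < inner ℝ (x : Amb q) (y : Amb q))

theorem tendsto_localIntegral_compl_cap (hL : IsDirectionalKernel L) (hψ : ModerateGrowth ψ)
    (hG : Continuous G) (x : ℝ → Sph q) (B : ℝ → Matrix (Fin (q + 1)) (Fin q) ℝ)
    (hB : ∀ h, IsProjectionMatrix (x h) (B h)) :
    Tendsto (fun h => (h ^ q)⁻¹ *
      ∫ y in (cap (x h))ᶜ, localKernel L ψ h (x h) (B h) y * G y ∂surfaceMeasure q)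
      (𝓝[>] 0) (𝓝 0) := by
  obtain ⟨C, β, hC, hβ, hle⟩ := exists_abs_localKernel_le hL hψ
  obtain ⟨D, hD, hGD⟩ := exists_abs_le_of_continuous hG
  have hlim := (tendsto_inv_pow_mul_exp_neg_div_sq q (half_pos hβ)).mul_const
    (C * D * (surfaceMeasure q).real Set.univ)
  rw [zero_mul] at hlim
  refine squeeze_zero_norm' ?_ hlim
  filter_upwards [self_mem_nhdsWithin] with h (hh : 0 < h)
  have hfar : ∀ y ∈ (cap (x h))ᶜ,
      ‖localKernel L ψ h (x h) (B h) y * G y‖ ≤ C * Real.exp (-(β / 2) / h ^ 2) * D := by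
    intro y hy
    have hinner : inner ℝ (x h : Amb q) (y : Amb q) ≤ 1 / 2 := not_lt.mp hy
    rw [Real.norm_eq_abs, abs_mul]
    refine mul_le_mul ((hle h _ _ y (hB h)).trans ?_) (hGD y) (abs_nonneg _) (by positivity)
    gcongr
    rw [neg_mul, neg_div, neg_le_neg_iff, ← mul_div_assoc]
    gcongr
    nlinarith
  calc _ = (h ^ q)⁻¹ * ‖∫ y in (cap (x h))ᶜ,
          localKernel L ψ h (x h) (B h) y * G y ∂surfaceMeasure q‖ := by
        rw [norm_mul, Real.norm_of_nonneg (by positivity)]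
    _ ≤ (h ^ q)⁻¹ * (C * Real.exp (-(β / 2) / h ^ 2) * D *
          (surfaceMeasure q).real Set.univ) := by
        gcongr
        refine (norm_setIntegral_le_of_norm_le_const (measure_lt_top _ _) hfar).trans ?_
        exact mul_le_mul_of_nonneg_left (measureReal_mono (Set.subset_univ _)) (by positivity)
    _ = _ := by ring

/-- The contribution of the cap at `x` to a local integral, in rescaled gnomonic coordinates. -/
def nearIntegrand (L : ℝ → ℝ) (ψ : EuclideanSpace ℝ (Fin q) → ℝ) (G : Sph q → ℝ) (h : ℝ)
    (x : Sph q) (B : Matrix (Fin (q + 1)) (Fin q) ℝ) (u : EuclideanSpace ℝ (Fin q)) : ℝ :=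
  (√(1 + ‖h • u‖ ^ 2))⁻¹ ^ (q + 1) *
    (cap x).indicator (fun y => localKernel L ψ h x B y * G y) (gnomonic x B (h • u))

theorem measurable_indicator_cap (hL : IsDirectionalKernel L) (hψ : Continuous ψ)
    (hG : Continuous G) (h : ℝ) (x : Sph q) (B : Matrix (Fin (q + 1)) (Fin q) ℝ) :
    Measurable ((cap x).indicator fun y => localKernel L ψ h x B y * G y) :=
  ((continuous_localKernel hL hψ h x B).mul hG).measurable.indicator (measurableSet_cap x)

theorem measurable_nearIntegrand (hL : IsDirectionalKernel L) (hψ : Continuous ψ)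
    (hG : Continuous G) (h : ℝ) (x : Sph q) (B : Matrix (Fin (q + 1)) (Fin q) ℝ) :
    Measurable (nearIntegrand L ψ G h x B) := by
  have hgnomonic : Measurable fun u : EuclideanSpace ℝ (Fin q) => gnomonic x B (h • u) :=
    (measurable_gnomonic x B).comp (by fun_prop)
  exact Measurable.mul (by fun_prop) ((measurable_indicator_cap hL hψ hG h x B).comp hgnomonic)

theorem IsProjectionMatrix.integral_nearIntegrand (hL : IsDirectionalKernel L) (hψ : Continuous ψ)
    (hG : Continuous G) {h : ℝ} (hh : 0 ≤ h) {x : Sph q} {B : Matrix (Fin (q + 1)) (Fin q) ℝ}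
    (hB : IsProjectionMatrix x B) :
    ∫ u, nearIntegrand L ψ G h x B u =
      (h ^ q)⁻¹ * ∫ y in cap x, localKernel L ψ h x B y * G y ∂surfaceMeasure q := by
  rw [← Set.inter_eq_self_of_subset_right (cap_subset_hemisphere x),
    ← setIntegral_indicator (measurableSet_cap x),
    hB.integral_hemisphere (measurable_indicator_cap hL hψ hG h x B)]
  have hscale := Measure.integral_comp_smul_of_nonneg (volume : Measure (EuclideanSpace ℝ (Fin q)))
    (fun v => (√(1 + ‖v‖ ^ 2))⁻¹ ^ (q + 1) *
      (cap x).indicator (fun y => localKernel L ψ h x B y * G y) (gnomonic x B v)) h (hR := hh)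
  rwa [finrank_euclideanSpace_fin, smul_eq_mul] at hscale

theorem IsProjectionMatrix.one_sub_inner_gnomonic_div_sq {x : Sph q}
    {B : Matrix (Fin (q + 1)) (Fin q) ℝ} (hB : IsProjectionMatrix x B) {h : ℝ} (hh : h ≠ 0)
    (u : EuclideanSpace ℝ (Fin q)) :
    (1 - inner ℝ (x : Amb q) (gnomonic x B (h • u) : Amb q)) / h ^ 2 =
      ‖u‖ ^ 2 / (√(1 + ‖h • u‖ ^ 2) * (1 + √(1 + ‖h • u‖ ^ 2))) := by
  have hs : √(1 + ‖h • u‖ ^ 2) ^ 2 = 1 + h ^ 2 * ‖u‖ ^ 2 := by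
    rw [Real.sq_sqrt (by positivity), norm_smul, mul_pow, Real.norm_eq_abs, sq_abs]
  have hpos : 0 < √(1 + ‖h • u‖ ^ 2) := by positivity
  rw [hB.inner_gnomonic]
  generalize √(1 + ‖h • u‖ ^ 2) = s at hs hpos
  field_simp
  linear_combination hs

theorem exists_abs_nearIntegrand_le (hL : IsDirectionalKernel L) (hψ : ModerateGrowth ψ)
    (hG : Continuous G) :
    ∃ C β : ℝ, 0 < β ∧ ∀ h x B u, h ≠ 0 → IsProjectionMatrix x B →
      |nearIntegrand L ψ G h x B u| ≤ C * Real.exp (-β * ‖u‖ ^ 2) := by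
  obtain ⟨C, β, hC, hβ, hle⟩ := exists_abs_localKernel_le hL hψ
  obtain ⟨D, hD, hGD⟩ := exists_abs_le_of_continuous hG
  refine ⟨C * D, β / 6, by positivity, fun h x B u hh hB => ?_⟩
  have hs : 1 ≤ √(1 + ‖h • u‖ ^ 2) := Real.one_le_sqrt.mpr (le_add_of_nonneg_right (by positivity))
  rw [nearIntegrand, abs_mul, abs_of_nonneg (by positivity)]
  refine (mul_le_of_le_one_left (abs_nonneg _)
    (pow_le_one₀ (by positivity) (inv_le_one_of_one_le₀ hs))).trans ?_
  by_cases hmem : gnomonic x B (h • u) ∈ cap x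
  · have hlt : √(1 + ‖h • u‖ ^ 2) < 2 := by
      rw [cap, Set.mem_ofPred_eq, hB.inner_gnomonic, one_div] at hmem
      exact (inv_lt_inv₀ two_pos (by positivity)).mp hmem
    rw [Set.indicator_of_mem hmem, abs_mul]
    calc _ ≤ C * Real.exp (-β * (‖u‖ ^ 2 / 6)) * D := by
          refine mul_le_mul ((hle h x B _ hB).trans ?_) (hGD _) (abs_nonneg _) (by positivity)
          rw [hB.one_sub_inner_gnomonic_div_sq hh, neg_mul, neg_mul]
          gcongr
          nlinarith
      _ = _ := by ring_nf
  · rw [Set.indicator_of_notMem hmem, abs_zero]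
    positivity

theorem tendsto_sqrt_one_add_norm_smul_sq {E : Type*} [NormedAddCommGroup E] [NormedSpace ℝ E]
    (u : E) : Tendsto (fun h : ℝ => √(1 + ‖h • u‖ ^ 2)) (𝓝[>] 0) (𝓝 1) := by
  have hcont : Continuous fun h : ℝ => √(1 + ‖h • u‖ ^ 2) := by fun_prop
  simpa using (hcont.tendsto 0).mono_left nhdsWithin_le_nhds

section Pointwise

variable {x : ℝ → Sph q} {B : ℝ → Matrix (Fin (q + 1)) (Fin q) ℝ}
  (hB : ∀ h, IsProjectionMatrix (x h) (B h)) (u : EuclideanSpace ℝ (Fin q))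

include hB

theorem tendsto_inner_gnomonic_smul :
    Tendsto (fun h => inner ℝ (x h : Amb q) (gnomonic (x h) (B h) (h • u) : Amb q))
      (𝓝[>] 0) (𝓝 1) := by
  simp only [(hB _).inner_gnomonic]
  simpa using (tendsto_sqrt_one_add_norm_smul_sq u).inv₀ one_ne_zero

theorem tendsto_dist_gnomonic_smul :
    Tendsto (fun h => dist (gnomonic (x h) (B h) (h • u)) (x h)) (𝓝[>] 0) (𝓝 0) := by
  have hdist (y z : Sph q) : dist y z = √(2 - 2 * inner ℝ (z : Amb q) (y : Amb q)) := by
    rw [Subtype.dist_eq, dist_eq_norm, ← Real.sqrt_sq (norm_nonneg _), @norm_sub_sq_real,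
      norm_eq_of_mem_sphere, norm_eq_of_mem_sphere, real_inner_comm]
    ring_nf
  simp only [hdist]
  simpa using (((tendsto_inner_gnomonic_smul hB u).const_mul 2).const_sub 2).sqrt

theorem tendsto_comp_gnomonic_smul_sub (hG : Continuous G) :
    Tendsto (fun h => G (gnomonic (x h) (B h) (h • u)) - G (x h)) (𝓝[>] 0) (𝓝 0) := by
  have hnear : Tendsto (fun h => (gnomonic (x h) (B h) (h • u), x h)) (𝓝[>] 0)
      (uniformity (Sph q)) :=
    tendsto_uniformity_iff_dist_tendsto_zero.mpr (tendsto_dist_gnomonic_smul hB u)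
  have himage := tendsto_uniformity_iff_dist_tendsto_zero.mp
    (Tendsto.comp (CompactSpace.uniformContinuous_of_continuous hG) hnear)
  exact (tendsto_zero_iff_abs_tendsto_zero _).mpr himage

theorem tendsto_localKernel_gnomonic_smul (hL : IsDirectionalKernel L) (hψ : Continuous ψ) :
    Tendsto (fun h => localKernel L ψ h (x h) (B h) (gnomonic (x h) (B h) (h • u)))
      (𝓝[>] 0) (𝓝 (L (‖u‖ ^ 2 / 2) * ψ u)) := by
  have hs := tendsto_sqrt_one_add_norm_smul_sq u
  have harg : Tendsto (fun h : ℝ => ‖u‖ ^ 2 / (√(1 + ‖h • u‖ ^ 2) * (1 + √(1 + ‖h • u‖ ^ 2))))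
      (𝓝[>] 0) (𝓝[Set.Ici 0] (‖u‖ ^ 2 / 2)) := by
    refine tendsto_nhdsWithin_iff.mpr
      ⟨?_, Eventually.of_forall fun h => Set.mem_Ici.mpr (by positivity)⟩
    have hdiv := (tendsto_const_nhds (x := ‖u‖ ^ 2)).div (hs.mul (hs.const_add 1)) (by norm_num)
    rwa [one_mul, one_add_one_eq_two] at hdiv
  have hcoord : Tendsto (fun h : ℝ => (√(1 + ‖h • u‖ ^ 2))⁻¹ • u) (𝓝[>] 0) (𝓝 u) := by
    simpa using (hs.inv₀ one_ne_zero).smul_const u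
  have hkernel := ((hL.continuousOn (‖u‖ ^ 2 / 2)
    (Set.mem_Ici.mpr (by positivity))).tendsto.comp harg).mul ((hψ.tendsto u).comp hcoord)
  refine hkernel.congr' ?_
  filter_upwards [self_mem_nhdsWithin] with h (hh : 0 < h)
  simp only [Function.comp_apply, localKernel, (hB h).one_sub_inner_gnomonic_div_sq hh.ne',
    (hB h).tangentCoord_gnomonic, smul_comm _ h u, inv_smul_smul₀ hh.ne']

theorem tendsto_nearIntegrand_sub (hL : IsDirectionalKernel L) (hψ : Continuous ψ)
    (hG : Continuous G) :
    Tendsto (fun h => nearIntegrand L ψ G h (x h) (B h) u - G (x h) * (L (‖u‖ ^ 2 / 2) * ψ u))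
      (𝓝[>] 0) (𝓝 0) := by
  obtain ⟨D, -, hGD⟩ := exists_abs_le_of_continuous hG
  have hjac : Tendsto (fun h : ℝ => (√(1 + ‖h • u‖ ^ 2))⁻¹ ^ (q + 1)) (𝓝[>] 0) (𝓝 1) := by
    simpa using ((tendsto_sqrt_one_add_norm_smul_sq u).inv₀ one_ne_zero).pow (q + 1)
  have hkernel := hjac.mul (tendsto_localKernel_gnomonic_smul hB u hL hψ)
  rw [one_mul] at hkernel
  have hbounded : IsBoundedUnder (· ≤ ·) (𝓝[>] (0 : ℝ)) ((‖·‖) ∘ fun h => G (x h)) :=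
    isBoundedUnder_of ⟨D, fun h => hGD (x h)⟩
  have hsum := (hkernel.mul (tendsto_comp_gnomonic_smul_sub hB u hG)).add
    ((tendsto_sub_nhds_zero_iff.mpr hkernel).zero_mul_isBoundedUnder_le hbounded)
  rw [mul_zero, add_zero] at hsum
  refine hsum.congr' ?_
  filter_upwards [(tendsto_inner_gnomonic_smul hB u).eventually_const_lt one_half_lt_one]
    with h hcap
  rw [nearIntegrand, Set.indicator_of_mem (by exact hcap)]
  ring

theorem tendsto_integral_nearIntegrand_sub (hL : IsDirectionalKernel L) (hψ : ModerateGrowth ψ)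
    (hG : Continuous G) :
    Tendsto (fun h => (∫ u, nearIntegrand L ψ G h (x h) (B h) u) - G (x h) * kernelMoment L ψ)
      (𝓝[>] 0) (𝓝 0) := by
  obtain ⟨C, β, hβ, hle⟩ := exists_abs_nearIntegrand_le hL hψ hG
  obtain ⟨D, -, hGD⟩ := exists_abs_le_of_continuous hG
  have hgauss := (integrable_exp_neg_mul_norm_sq (V := EuclideanSpace ℝ (Fin q)) hβ).const_mul C
  have hker := hψ.integrable_kernel hL
  have hmeas (h : ℝ) : AEStronglyMeasurable (nearIntegrand L ψ G h (x h) (B h)) volume :=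
    (measurable_nearIntegrand hL hψ.continuous hG _ _ _).aestronglyMeasurable
  have hlim : Tendsto (fun h => ∫ u, (nearIntegrand L ψ G h (x h) (B h) u -
      G (x h) * (L (‖u‖ ^ 2 / 2) * ψ u))) (𝓝[>] 0)
      (𝓝 (∫ _ : EuclideanSpace ℝ (Fin q), (0 : ℝ))) := by
    refine tendsto_integral_filter_of_dominated_convergence
      (fun u => C * Real.exp (-β * ‖u‖ ^ 2) + D * |L (‖u‖ ^ 2 / 2) * ψ u|)
      (Eventually.of_forall fun h => (hmeas h).sub (hker.const_mul _).aestronglyMeasurable) ?_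
      (hgauss.add (hker.abs.const_mul D))
      (ae_of_all _ fun u => tendsto_nearIntegrand_sub hB u hL hψ.continuous hG)
    filter_upwards [self_mem_nhdsWithin] with h (hh : 0 < h)
    refine ae_of_all _ fun u => (norm_sub_le _ _).trans
      (add_le_add (hle h _ _ u hh.ne' (hB h)) ?_)
    rw [Real.norm_eq_abs, abs_mul]
    exact mul_le_mul_of_nonneg_right (hGD _) (abs_nonneg _)
  rw [integral_zero] at hlim
  refine hlim.congr' ?_
  filter_upwards [self_mem_nhdsWithin] with h (hh : 0 < h)
  have hint : Integrable (nearIntegrand L ψ G h (x h) (B h)) :=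
    hgauss.mono' (hmeas h) (ae_of_all _ fun u => hle h _ _ u hh.ne' (hB h))
  rw [integral_sub hint (hker.const_mul _), integral_const_mul]
  rfl

end Pointwise

theorem tendstoUniformly_localIntegral (hL : IsDirectionalKernel L) (hψ : ModerateGrowth ψ)
    (hG : Continuous G) {B : Sph q → Matrix (Fin (q + 1)) (Fin q) ℝ}
    (hB : ∀ x, IsProjectionMatrix x (B x)) :
    TendstoUniformly (fun h x => (h ^ q)⁻¹ * localIntegral L ψ G h x (B x))
      (fun x => G x * kernelMoment L ψ) (𝓝[>] 0) := by
  refine tendstoUniformly_of_forall_tendsto_dist fun x => ?_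
  have hsum := (tendsto_integral_nearIntegrand_sub (fun h => hB (x h)) hL hψ hG).add
    (tendsto_localIntegral_compl_cap hL hψ hG x (fun h => B (x h)) fun h => hB (x h))
  rw [add_zero] at hsum
  refine ((tendsto_zero_iff_abs_tendsto_zero _).mp hsum).congr' ?_
  filter_upwards [self_mem_nhdsWithin] with h (hh : 0 < h)
  have hint : Integrable (fun y => localKernel L ψ h (x h) (B (x h)) y * G y) (surfaceMeasure q) :=
    ((continuous_localKernel hL hψ.continuous _ _ _).mul hG).integrable_of_hasCompactSupport
      (.of_compactSpace _)
  rw [Function.comp_apply, (hB (x h)).integral_nearIntegrand hL hψ.continuous hG hh.le,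
    sub_add_eq_add_sub, ← mul_add, integral_add_compl (measurableSet_cap _) hint, dist_comm,
    Real.dist_eq]
  rfl

theorem eventually_localIntegral_le (hL : IsDirectionalKernel L) (hψ : ModerateGrowth ψ)
    (hG : Continuous G) {B : Sph q → Matrix (Fin (q + 1)) (Fin q) ℝ}
    (hB : ∀ x, IsProjectionMatrix x (B x)) :
    ∃ C : ℝ, ∀ᶠ h in 𝓝[>] 0, ∀ x, localIntegral L ψ G h x (B x) ≤ C * h ^ q := by
  obtain ⟨D, -, hGD⟩ := exists_abs_le_of_continuous hG
  refine ⟨D * |kernelMoment L ψ| + 1, ?_⟩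
  filter_upwards [self_mem_nhdsWithin, Metric.tendstoUniformly_iff.mp
    (tendstoUniformly_localIntegral hL hψ hG hB) 1 one_pos] with h (hh : 0 < h) hclose x
  have hupper : (h ^ q)⁻¹ * localIntegral L ψ G h x (B x) < G x * kernelMoment L ψ + 1 :=
    sub_lt_iff_lt_add'.mp (abs_sub_lt_iff.mp (hclose x)).2
  have hlimit : G x * kernelMoment L ψ ≤ D * |kernelMoment L ψ| :=
    (le_abs_self _).trans ((abs_mul _ _).trans_le (by gcongr; exact hGD x))
  rw [mul_comm, ← inv_mul_le_iff₀ (by positivity)]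
  linarith

end Kernel

section KernelMass

variable {q : ℕ} {L : ℝ → ℝ}

theorem IsDirectionalKernel.exists_pos (hL : IsDirectionalKernel L) : ∃ r, 0 < r ∧ 0 < L r := by
  obtain ⟨r, hr, hLr⟩ := hL.nontrivial
  have hpos : 0 < L r := (hL.nonneg r hr).lt_of_ne' hLr
  have hnear : ∀ᶠ s in 𝓝[>] r, 0 < L s :=
    ((hL.continuousOn r hr).eventually_const_lt hpos).filter_mono
      (nhdsWithin_mono _ fun s hs => hr.trans (le_of_lt hs))
  obtain ⟨s, hs, hrs⟩ := (hnear.and self_mem_nhdsWithin).exists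
  exact ⟨s, hr.trans_lt hrs, hs⟩

theorem kernelMoment_pos {V : Type*} [NormedAddCommGroup V] [InnerProductSpace ℝ V]
    [FiniteDimensional ℝ V] [MeasurableSpace V] [BorelSpace V] [Nontrivial V]
    (hL : IsDirectionalKernel L) {ψ : V → ℝ} (hψ : ModerateGrowth ψ) (hnonneg : ∀ u, 0 ≤ ψ u)
    (hnonzero : ∀ u₀, ¬∀ᶠ u in 𝓝 u₀, ψ u = 0) : 0 < kernelMoment L ψ := by
  have hLc : Continuous fun u : V => L (‖u‖ ^ 2 / 2) :=
    hL.continuous_comp (by fun_prop) fun u => by positivity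
  rw [kernelMoment, integral_pos_iff_support_of_nonneg
    (fun u => mul_nonneg (hL.nonneg _ (by positivity)) (hnonneg u)) (hψ.integrable_kernel hL)]
  refine (hLc.mul hψ.continuous).isOpen_support.measure_pos _ ?_
  obtain ⟨r, hr, hLr⟩ := hL.exists_pos
  obtain ⟨u₀, hu₀⟩ := exists_norm_eq V (Real.sqrt_nonneg (2 * r))
  have hLu₀ : L (‖u₀‖ ^ 2 / 2) ≠ 0 := by
    rw [hu₀, Real.sq_sqrt (by positivity), mul_div_cancel_left₀ _ two_ne_zero]
    exact hLr.ne'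
  by_contra hempty
  rw [Set.not_nonempty_iff_eq_empty, Function.support_eq_empty_iff] at hempty
  refine hnonzero u₀ ?_
  filter_upwards [hLc.continuousAt.eventually_ne hLu₀] with u hu
  exact (mul_eq_zero.mp (congrFun hempty u)).resolve_left hu

theorem lowerArea_pos (hq : 1 ≤ q) : 0 < lowerArea q := by
  have _ : 0 < Real.Gamma ((q : ℝ) / 2) := Real.Gamma_pos_of_pos (by positivity)
  unfold lowerArea
  positivity

theorem natCast_mul_volume_ball (hq : 1 ≤ q) :
    (q : ℝ) * (volume : Measure (EuclideanSpace ℝ (Fin q))).real (Metric.ball 0 1) =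
      lowerArea q := by
  have : Nonempty (Fin q) := ⟨⟨0, hq⟩⟩
  have _ : 0 < Real.Gamma ((q : ℝ) / 2) := Real.Gamma_pos_of_pos (by positivity)
  have hpi : √Real.pi ^ q = Real.pi ^ ((q : ℝ) / 2) := by
    rw [Real.sqrt_eq_rpow, ← Real.rpow_natCast, ← Real.rpow_mul Real.pi_pos.le, one_div_mul_eq_div]
  rw [measureReal_def, EuclideanSpace.volume_ball, Fintype.card_fin, ENNReal.ofReal_one, one_pow,
    one_mul, Real.Gamma_add_one (by positivity), ENNReal.toReal_ofReal (by positivity), hpi,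
    lowerArea]
  field_simp

theorem integral_Ioi_pow_mul_comp_sq_div_two (hq : 1 ≤ q) (g : ℝ → ℝ) :
    ∫ t in Set.Ioi (0 : ℝ), t ^ (q - 1) * g (t ^ 2 / 2) =
      2 ^ ((q : ℝ) / 2 - 1) * ∫ r in Set.Ioi (0 : ℝ), g r * r ^ ((q : ℝ) / 2 - 1) := by
  have hsq := integral_comp_rpow_Ioi_of_pos
    (g := fun s => g (s / 2) * s ^ ((q : ℝ) / 2 - 1)) (p := 2) two_pos
  have hdouble := integral_comp_mul_left_Ioi (fun s => g (s / 2) * s ^ ((q : ℝ) / 2 - 1)) 0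
    (two_pos : (0 : ℝ) < 2)
  rw [mul_zero, smul_eq_mul, ← hsq, ← integral_const_mul] at hdouble
  rw [← integral_const_mul]
  calc ∫ t in Set.Ioi (0 : ℝ), t ^ (q - 1) * g (t ^ 2 / 2)
      = ∫ t in Set.Ioi (0 : ℝ), 2⁻¹ * ((2 * t ^ ((2 : ℝ) - 1)) •
          (g (t ^ (2 : ℝ) / 2) * (t ^ (2 : ℝ)) ^ ((q : ℝ) / 2 - 1))) := by
        refine setIntegral_congr_fun measurableSet_Ioi fun t (ht : 0 < t) => ?_
        have hexp : t ^ (q - 1) = t ^ ((2 : ℝ) - 1) * (t ^ (2 : ℝ)) ^ ((q : ℝ) / 2 - 1) := by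
          rw [← Real.rpow_mul ht.le, ← Real.rpow_add ht, ← Real.rpow_natCast, Nat.cast_sub hq]
          congr 1
          push_cast
          ring
        rw [hexp, Real.rpow_two, smul_eq_mul]
        ring
    _ = ∫ r in Set.Ioi (0 : ℝ), g (2 * r / 2) * (2 * r) ^ ((q : ℝ) / 2 - 1) := hdouble.symm
    _ = ∫ r in Set.Ioi (0 : ℝ), 2 ^ ((q : ℝ) / 2 - 1) * (g r * r ^ ((q : ℝ) / 2 - 1)) := by
        refine setIntegral_congr_fun measurableSet_Ioi fun r (hr : 0 < r) => ?_
        rw [mul_div_cancel_left₀ _ two_ne_zero, Real.mul_rpow two_pos.le hr.le]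
        ring

theorem kernelMoment_one (hq : 1 ≤ q) (L : ℝ → ℝ) :
    kernelMoment L (fun _ : EuclideanSpace ℝ (Fin q) => 1) = kernelMass q L := by
  have : Nonempty (Fin q) := ⟨⟨0, hq⟩⟩
  have hpolar := integral_fun_norm_addHaar (volume : Measure (EuclideanSpace ℝ (Fin q)))
    (fun t => L (t ^ 2 / 2))
  simp only [finrank_euclideanSpace, Fintype.card_fin, smul_eq_mul, nsmul_eq_mul,
    integral_Ioi_pow_mul_comp_sq_div_two hq] at hpolar
  simp only [kernelMoment, mul_one]
  rw [hpolar, kernelMass, ← natCast_mul_volume_ball hq]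
  ring

theorem kernelMass_pos (hq : 1 ≤ q) (hL : IsDirectionalKernel L) : 0 < kernelMass q L := by
  have : Nonempty (Fin q) := ⟨⟨0, hq⟩⟩
  rw [← kernelMoment_one hq]
  exact kernelMoment_pos hL (.const 1) (fun _ => zero_le_one) fun u₀ h => by simpa using h.exists

theorem intervalIntegrable_rpow_mul_sub_rpow_half {s t b : ℝ} (hs : -1 < s) (hb : 0 < b) :
    IntervalIntegrable (fun r : ℝ => r ^ s * (b - r) ^ t) volume 0 (b / 2) := by
  refine (intervalIntegral.intervalIntegrable_rpow' hs).mul_continuousOn ?_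
  refine ContinuousOn.rpow_const (by fun_prop) fun r hr => Or.inl ?_
  rw [Set.uIcc_of_le (by positivity)] at hr
  linarith [hr.2]

theorem intervalIntegrable_rpow_mul_sub_rpow {s t b : ℝ} (hs : -1 < s) (ht : -1 < t)
    (hb : 0 < b) : IntervalIntegrable (fun r : ℝ => r ^ s * (b - r) ^ t) volume 0 b := by
  have hright := ((intervalIntegrable_rpow_mul_sub_rpow_half (t := s) ht hb).comp_sub_left b).symm
  simp only [sub_sub_cancel, sub_zero, sub_half, mul_comm _ (_ ^ s)] at hright
  exact (intervalIntegrable_rpow_mul_sub_rpow_half hs hb).trans hright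

theorem intervalIntegrable_kernelMassAt (hq : 1 ≤ q) (hL : IsDirectionalKernel L) {h : ℝ}
    (hh : 0 < h) :
    IntervalIntegrable (fun r => L r * r ^ ((q : ℝ) / 2 - 1) *
      (2 - r * h ^ 2) ^ ((q : ℝ) / 2 - 1)) volume 0 (2 / h ^ 2) := by
  have hb : 0 < 2 / h ^ 2 := by positivity
  have hs : -1 < (q : ℝ) / 2 - 1 := by
    have : (0 : ℝ) < q := by exact_mod_cast hq
    linarith [half_pos this]
  have hLc : ContinuousOn (fun r => L r * (h ^ 2) ^ ((q : ℝ) / 2 - 1))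
      (Set.uIcc 0 (2 / h ^ 2)) := by
    rw [Set.uIcc_of_le hb.le]
    exact (hL.continuousOn.mono fun r hr => hr.1).mul continuousOn_const
  refine ((intervalIntegrable_rpow_mul_sub_rpow hs hs hb).continuousOn_mul hLc).congr
    fun r hr => ?_
  rw [Set.uIoc_of_le hb.le] at hr
  have hfactor : 2 - r * h ^ 2 = h ^ 2 * (2 / h ^ 2 - r) := by field_simp
  simp only [hfactor, Real.mul_rpow (sq_nonneg h) (sub_nonneg.mpr hr.2)]
  ring

theorem kernelMassAt_pos (hq : 1 ≤ q) (hL : IsDirectionalKernel L) {r h : ℝ} (hr : 0 < r)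
    (hLr : 0 < L r) (hh : 0 < h) (hrh : r < 2 / h ^ 2) : 0 < kernelMassAt q L h := by
  have hb : 0 < 2 / h ^ 2 := by positivity
  refine mul_pos (lowerArea_pos hq) ?_
  rw [intervalIntegral.integral_of_le hb.le, setIntegral_pos_iff_support_of_nonneg_ae _
    (intervalIntegrable_kernelMassAt hq hL hh).1]
  · have hopen : IsOpen (Set.Ioo 0 (2 / h ^ 2) ∩ L ⁻¹' {0}ᶜ) :=
      (hL.continuousOn.mono fun s hs => hs.1.le).isOpen_inter_preimage isOpen_Ioo
        isOpen_compl_singleton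
    refine (hopen.measure_pos volume ⟨r, ⟨hr, hrh⟩, hLr.ne'⟩).trans_le (measure_mono ?_)
    rintro s ⟨⟨hs₀, hs⟩, hLs⟩
    have hsub : 0 < 2 - s * h ^ 2 := sub_pos.mpr ((lt_div_iff₀ (by positivity)).mp hs)
    exact ⟨mul_ne_zero (mul_ne_zero hLs (Real.rpow_pos_of_pos hs₀ _).ne')
      (Real.rpow_pos_of_pos hsub _).ne', hs₀, hs.le⟩
  · filter_upwards [ae_restrict_mem measurableSet_Ioc] with s ⟨hs₀, hs⟩
    have hsub : 0 ≤ 2 - s * h ^ 2 := sub_nonneg.mpr ((le_div_iff₀ (by positivity)).mp hs)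
    exact mul_nonneg (mul_nonneg (hL.nonneg s hs₀.le) (Real.rpow_nonneg hs₀.le _))
      (Real.rpow_nonneg hsub _)

theorem eventually_kernelMassAt_pos (hq : 1 ≤ q) (hL : IsDirectionalKernel L) :
    ∀ᶠ h in 𝓝[>] 0, 0 < kernelMassAt q L h := by
  obtain ⟨r, hr, hLr⟩ := hL.exists_pos
  have hlim : Tendsto (fun h : ℝ => r * h ^ 2) (𝓝[>] 0) (𝓝 0) := by
    have : ContinuousAt (fun h : ℝ => r * h ^ 2) 0 := by fun_prop
    simpa using this.tendsto.mono_left nhdsWithin_le_nhds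
  filter_upwards [hlim.eventually_lt_const two_pos, self_mem_nhdsWithin] with h hrh hh
  exact kernelMassAt_pos hq hL hr hLr hh ((lt_div_iff₀ (pow_pos hh 2)).mpr hrh)

end KernelMass

section Gram

variable {q p : ℕ} {L : ℝ → ℝ}

/-- The regressors of the local fit of degree `p`, as functions of the rescaled tangent
coordinates `Bᵀ (X - x) / h`. -/
def regressor (p : ℕ) (a : Unit ⊕ (Fin p × Fin q)) (u : EuclideanSpace ℝ (Fin q)) : ℝ :=
  Sum.elim (fun _ => 1) (fun jk => u jk.2) a

theorem moderateGrowth_regressor (p : ℕ) (a : Unit ⊕ (Fin p × Fin q)) :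
    ModerateGrowth (regressor p a) := by
  rcases a with - | a
  · exact ModerateGrowth.const 1
  · exact ModerateGrowth.of_clm (EuclideanSpace.proj a.2 : EuclideanSpace ℝ (Fin q) →L[ℝ] ℝ)

theorem eq_zero_of_eventually_const_add_clm_eq_zero {E : Type*} [NormedAddCommGroup E]
    [NormedSpace ℝ E] {c : ℝ} {φ : E →L[ℝ] ℝ} {u₀ : E} (h : ∀ᶠ u in 𝓝 u₀, c + φ u = 0) :
    c = 0 ∧ φ = 0 := by
  have hφ : φ = 0 := (φ.hasFDerivAt.const_add c).unique
    ((hasFDerivAt_const (0 : ℝ) u₀).congr_of_eventuallyEq h)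
  refine ⟨?_, hφ⟩
  simpa [hφ] using h.self_of_nhds

theorem eq_zero_of_eventually_sum_regressor_eq_zero (hp : p ≤ 1) {v : Unit ⊕ (Fin p × Fin q) → ℝ}
    {u₀ : EuclideanSpace ℝ (Fin q)} (h : ∀ᶠ u in 𝓝 u₀, ∑ a, v a * regressor p a u = 0) :
    v = 0 := by
  have : Subsingleton (Fin p) := Fin.subsingleton_iff_le_one.mpr hp
  have haffine : ∀ᶠ u in 𝓝 u₀, v (Sum.inl ()) +
      (∑ k, ∑ j, v (Sum.inr (k, j)) • (EuclideanSpace.proj j : _ →L[ℝ] ℝ)) u = 0 := by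
    simpa [regressor, Fintype.sum_sum_type, Fintype.sum_prod_type] using h
  obtain ⟨hconst, hlinear⟩ := eq_zero_of_eventually_const_add_clm_eq_zero haffine
  funext a
  rcases a with ⟨⟩ | ⟨k, j⟩
  · exact hconst
  · have hj := congrArg (fun φ => φ (EuclideanSpace.single j 1)) hlinear
    simpa [Fintype.sum_subsingleton _ k, Finset.sum_ite_eq] using hj

/-- The Gram matrix of the regressors with respect to the limit kernel. -/
def gram (q p : ℕ) (L : ℝ → ℝ) : Matrix (Unit ⊕ (Fin p × Fin q)) (Unit ⊕ (Fin p × Fin q)) ℝ :=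
  Matrix.of fun a b => kernelMoment L fun u => regressor p a u * regressor p b u

theorem dotProduct_gram_mulVec (hL : IsDirectionalKernel L) (v : Unit ⊕ (Fin p × Fin q) → ℝ) :
    v ⬝ᵥ (gram q p L *ᵥ v) = kernelMoment L fun u => (∑ a, v a * regressor p a u) ^ 2 := by
  have hint (a b : Unit ⊕ (Fin p × Fin q)) := ((((moderateGrowth_regressor p a).mul
    (moderateGrowth_regressor p b)).integrable_kernel hL).const_mul (v a * v b))
  have hexpand (u : EuclideanSpace ℝ (Fin q)) :
      L (‖u‖ ^ 2 / 2) * (∑ a, v a * regressor p a u) ^ 2 = ∑ a, ∑ b,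
        v a * v b * (L (‖u‖ ^ 2 / 2) * (regressor p a u * regressor p b u)) := by
    rw [sq (∑ a, _), Finset.sum_mul_sum, Finset.mul_sum]
    refine Finset.sum_congr rfl fun a _ => ?_
    rw [Finset.mul_sum]
    exact Finset.sum_congr rfl fun b _ => by ring
  simp_rw [kernelMoment, hexpand]
  rw [integral_finsetSum _ fun a _ => integrable_finsetSum _ fun b _ => hint a b]
  refine Finset.sum_congr rfl fun a _ => ?_
  rw [integral_finsetSum _ fun b _ => hint a b, Matrix.mulVec, dotProduct, Finset.mul_sum]
  refine Finset.sum_congr rfl fun b _ => ?_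
  rw [integral_const_mul, gram, Matrix.of_apply, kernelMoment]
  ring

theorem posDef_gram (hq : 1 ≤ q) (hp : p ≤ 1) (hL : IsDirectionalKernel L) :
    (gram q p L).PosDef := by
  have : Nonempty (Fin q) := ⟨⟨0, hq⟩⟩
  have hsymm : (gram q p L).IsHermitian := by
    ext a b
    simp [gram, mul_comm]
  refine .of_dotProduct_mulVec_pos hsymm fun v hv => ?_
  have hgrowth : ModerateGrowth fun u => ∑ a, v a * regressor p a u :=
    .sum fun a => (ModerateGrowth.const (v a)).mul (moderateGrowth_regressor p a)
  rw [star_trivial, dotProduct_gram_mulVec hL]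
  refine kernelMoment_pos hL (by simpa only [sq] using hgrowth.mul hgrowth)
    (fun u => sq_nonneg _) fun u₀ h => hv ?_
  simp only [sq_eq_zero_iff] at h
  exact eq_zero_of_eventually_sum_regressor_eq_zero hp h

end Gram

section Negligible

variable {Ω ι : Type*} [MeasurableSpace Ω] {μ : Measure Ω} {S : Set ι} {A A' : ℕ → ι → Set Ω}

namespace UniformlyNegligible

theorem of_le {b : ℕ → ℝ≥0∞} (hb : Tendsto b atTop (𝓝 0))
    (h : ∀ᶠ n in atTop, ∀ x ∈ S, μ (A n x) ≤ b n) : UniformlyNegligible μ S A :=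
  tendsto_of_tendsto_of_tendsto_of_le_of_le' tendsto_const_nhds hb
    (Eventually.of_forall fun _ => zero_le) (h.mono fun _ hn => iSup₂_le hn)

theorem mono (h : UniformlyNegligible μ S A) (hsub : ∀ᶠ n in atTop, ∀ x ∈ S, A' n x ⊆ A n x) :
    UniformlyNegligible μ S A' :=
  of_le h (hsub.mono fun n hn x hx =>
    (measure_mono (hn x hx)).trans (le_biSup (fun x => μ (A n x)) hx))

theorem subset (h : UniformlyNegligible μ S A) {T : Set ι} (hT : T ⊆ S) :
    UniformlyNegligible μ T A :=
  of_le h (Eventually.of_forall fun n _ hx => le_biSup (fun x => μ (A n x)) (hT hx))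

theorem iUnion {κ : Type*} [Finite κ] {A : κ → ℕ → ι → Set Ω}
    (h : ∀ k, UniformlyNegligible μ S (A k)) :
    UniformlyNegligible μ S fun n x => ⋃ k, A k n x := by
  have : Fintype κ := Fintype.ofFinite κ
  have hsum : Tendsto (fun n => ∑ k, ⨆ x ∈ S, μ (A k n x)) atTop (𝓝 0) := by
    simpa using tendsto_finsetSum Finset.univ fun k _ => h k
  exact of_le hsum (Eventually.of_forall fun n x hx =>
    (measure_iUnion_fintype_le _ _).trans
      (Finset.sum_le_sum fun k _ => le_biSup (fun x => μ (A k n x)) hx))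

theorem union (h : UniformlyNegligible μ S A) (h' : UniformlyNegligible μ S A') :
    UniformlyNegligible μ S fun n x => A n x ∪ A' n x := by
  refine (iUnion (A := fun b : Bool => bif b then A else A')
    (Bool.forall_bool.mpr ⟨h', h⟩)).mono (Eventually.of_forall fun n x _ => ?_)
  rw [Set.union_eq_iUnion]
  exact Set.iUnion_mono fun b => by cases b <;> rfl

end UniformlyNegligible

theorem UniformOP.add_deterministic {R : ℕ → ι → Ω → ℝ} (hR : UniformOP μ S R)
    {d : ℕ → ι → ℝ} {e : ι → ℝ} (hd : TendstoUniformly d e atTop) :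
    UniformOP μ S fun n x ω => R n x ω + (d n x - e x) := by
  intro δ hδ
  refine (hR (δ / 2) (by positivity)).mono ?_
  filter_upwards [Metric.tendstoUniformly_iff.mp hd (δ / 2) (by positivity)] with n hn x _ ω
    (hω : δ ≤ |R n x ω + (d n x - e x)|)
  have hde := hn x
  rw [dist_comm, Real.dist_eq] at hde
  change δ / 2 ≤ |R n x ω|
  linarith [abs_add_le (R n x ω) (d n x - e x)]

namespace UniformOP

variable {R R' : ℕ → ι → Ω → ℝ}

theorem of_abs_le (hR : UniformOP μ S R)
    (h : ∀ᶠ n in atTop, ∀ x ∈ S, ∀ ω, |R' n x ω| ≤ |R n x ω|) : UniformOP μ S R' :=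
  fun δ hδ => (hR δ hδ).mono (h.mono fun _ hn x hx ω hω => le_trans hω (hn x hx ω))

theorem subset (hR : UniformOP μ S R) {T : Set ι} (hT : T ⊆ S) : UniformOP μ T R :=
  fun δ hδ => (hR δ hδ).subset hT

theorem sub (hR : UniformOP μ S R) (hR' : UniformOP μ S R') :
    UniformOP μ S fun n x ω => R n x ω - R' n x ω := by
  intro δ hδ
  refine ((hR (δ / 2) (by positivity)).union (hR' (δ / 2) (by positivity))).mono
    (Eventually.of_forall fun n x _ ω (hω : δ ≤ |R n x ω - R' n x ω|) => ?_)
  change δ / 2 ≤ |R n x ω| ∨ δ / 2 ≤ |R' n x ω|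
  by_contra! hlt
  linarith [abs_sub (R n x ω) (R' n x ω)]

theorem div (hR : UniformOP μ S R) {D : ℕ → ι → Ω → ℝ} {c : ℝ} (hc : 0 < c)
    (hD : UniformlyNegligible μ S fun n x => {ω | |D n x ω| < c}) :
    UniformOP μ S fun n x ω => R n x ω / D n x ω := by
  intro δ hδ
  refine (hD.union (hR (δ * c) (by positivity))).mono
    (Eventually.of_forall fun n x _ ω (hω : δ ≤ |R n x ω / D n x ω|) => ?_)
  change |D n x ω| < c ∨ δ * c ≤ |R n x ω|
  refine or_iff_not_imp_left.mpr fun hDc => ?_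
  have hcD : c ≤ |D n x ω| := not_lt.mp hDc
  rw [abs_div, le_div_iff₀ (hc.trans_le hcD)] at hω
  exact (mul_le_mul_of_nonneg_left hcD hδ.le).trans hω

theorem negligible_abs_lt {θ : ι → ℝ} (hR : UniformOP μ S fun n x ω => R n x ω - θ x) {b c : ℝ}
    (hθ : ∀ x ∈ S, c ≤ |θ x|) (hbc : b < c) :
    UniformlyNegligible μ S fun n x => {ω | |R n x ω| < b} :=
  (hR (c - b) (sub_pos.mpr hbc)).mono
    (Eventually.of_forall fun n x hx ω (hω : |R n x ω| < b) => by
      change c - b ≤ |R n x ω - θ x|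
      linarith [hθ x hx, abs_sub_abs_le_abs_sub (θ x) (R n x ω), abs_sub_comm (θ x) (R n x ω)])

theorem dist_pi {κ E : Type*} [Fintype κ] [PseudoMetricSpace E] {V : ℕ → ι → Ω → κ → E}
    {v : ι → κ → E} (hV : ∀ k, UniformOP μ S fun n x ω => dist (V n x ω k) (v x k)) :
    UniformOP μ S fun n x ω => dist (V n x ω) (v x) := by
  intro δ hδ
  refine (UniformlyNegligible.iUnion fun k => hV k δ hδ).mono
    (Eventually.of_forall fun n x _ ω (hω : δ ≤ |dist (V n x ω) (v x)|) => ?_)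
  rw [abs_of_nonneg dist_nonneg] at hω
  by_contra hlt
  simp only [Set.mem_iUnion, Set.mem_ofPred_eq, not_exists, not_le, abs_dist] at hlt
  exact hω.not_gt ((dist_pi_lt_iff hδ).mpr hlt)

theorem dist_prod {E F : Type*} [PseudoMetricSpace E] [PseudoMetricSpace F]
    {V : ℕ → ι → Ω → E} {v : ι → E} {W : ℕ → ι → Ω → F} {w : ι → F}
    (hV : UniformOP μ S fun n x ω => dist (V n x ω) (v x))
    (hW : UniformOP μ S fun n x ω => dist (W n x ω) (w x)) :
    UniformOP μ S fun n x ω => dist (V n x ω, W n x ω) (v x, w x) := by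
  intro δ hδ
  refine ((hV δ hδ).union (hW δ hδ)).mono (Eventually.of_forall fun n x _ ω
    (hω : δ ≤ |dist (V n x ω, W n x ω) (v x, w x)|) => ?_)
  rw [abs_of_nonneg dist_nonneg, Prod.dist_eq, le_max_iff] at hω
  exact hω.imp (fun h => h.trans (le_abs_self _)) fun h => h.trans (le_abs_self _)

/-- The continuous mapping theorem: `Φ` is uniformly continuous near the compact set `K`. -/
theorem comp_of_isCompact {E : Type*} [PseudoMetricSpace E] {V : ℕ → ι → Ω → E} {v : ι → E}
    (hV : UniformOP μ S fun n x ω => dist (V n x ω) (v x)) {K : Set E} (hK : IsCompact K)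
    (hvK : ∀ x ∈ S, v x ∈ K) {Φ : E → ℝ} (hΦ : ∀ z ∈ K, ContinuousAt Φ z) :
    UniformOP μ S fun n x ω => Φ (V n x ω) - Φ (v x) := by
  intro δ hδ
  obtain ⟨ρ, hρ, hnear⟩ := Metric.mem_uniformity_dist.mp
    (hK.uniformContinuousAt_of_continuousAt Φ hΦ (Metric.dist_mem_uniformity hδ))
  refine (hV ρ hρ).mono (Eventually.of_forall fun n x hx ω
    (hω : δ ≤ |Φ (V n x ω) - Φ (v x)|) => ?_)
  change ρ ≤ |dist (V n x ω) (v x)|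
  rw [abs_dist, dist_comm]
  rw [← Real.dist_eq, dist_comm] at hω
  by_contra! hlt
  exact hω.not_gt (hnear hlt (hvK x hx))

end UniformOP

end Negligible

section LawOfLargeNumbers

variable {Ω : Type*} [MeasurableSpace Ω] {μ : Measure Ω} [IsProbabilityMeasure μ]

theorem measure_le_abs_sum_sub_card_mul_integral_le {κ : Type*} [Fintype κ] {W : κ → Ω → ℝ}
    {W₀ : Ω → ℝ} (hindep : Pairwise fun i j => IndepFun (W i) (W j) μ)
    (hident : ∀ i, IdentDistrib (W i) W₀ μ μ) (hmem : MemLp W₀ 2 μ) {c : ℝ} (hc : 0 < c) :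
    μ {ω | c ≤ |∑ i, W i ω - Fintype.card κ * ∫ ω, W₀ ω ∂μ|} ≤
      ENNReal.ofReal (Fintype.card κ * (∫ ω, W₀ ω ^ 2 ∂μ) / c ^ 2) := by
  have hmem' (i : κ) : MemLp (W i) 2 μ := (hident i).memLp_iff.mpr hmem
  have hvar : variance (∑ i, W i) μ ≤ Fintype.card κ * ∫ ω, W₀ ω ^ 2 ∂μ := by
    rw [IndepFun.variance_sum (fun i _ => hmem' i) fun i _ j _ hij => hindep hij,
      Finset.sum_congr rfl fun i _ => (hident i).variance_eq, Finset.sum_const, nsmul_eq_mul,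
      Finset.card_univ]
    gcongr
    exact variance_le_expectation_sq hmem.aestronglyMeasurable
  have hmean : ∫ ω, (∑ i, W i) ω ∂μ = Fintype.card κ * ∫ ω, W₀ ω ∂μ := by
    simp only [Finset.sum_apply]
    rw [integral_finsetSum _ fun i _ => (hmem' i).integrable one_le_two,
      Finset.sum_congr rfl fun i _ => (hident i).integral_eq, Finset.sum_const, nsmul_eq_mul,
      Finset.card_univ]
  have hcheb := meas_ge_le_variance_div_sq (memLp_finsetSum' Finset.univ fun i _ => hmem' i) hc
  rw [hmean] at hcheb
  simp only [Finset.sum_apply] at hcheb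
  exact hcheb.trans (ENNReal.ofReal_le_ofReal (by gcongr))

/-- A weak law of large numbers for triangular arrays. The summands are large, of order `1`, only
with probability of order `w n`, so that the effective sample size is `n * w n`. -/
theorem uniformOP_average {ι E : Type*} [MeasurableSpace E] {Z : ℕ → Ω → E}
    (hindep : Pairwise fun i j => IndepFun (Z i) (Z j) μ)
    (hident : ∀ i, IdentDistrib (Z i) (Z 0) μ μ) {φ : ℕ → ι → E → ℝ}
    (hφ : ∀ n x, Measurable (φ n x)) {w : ℕ → ℝ} (hw : ∀ n, 0 < w n)
    (hnw : Tendsto (fun n : ℕ => (n : ℝ) * w n) atTop atTop)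
    (hmem : ∀ n x, MemLp (fun ω => φ n x (Z 0 ω)) 2 μ)
    (hsq : ∃ C : ℝ, ∀ᶠ n in atTop, ∀ x, ∫ ω, φ n x (Z 0 ω) ^ 2 ∂μ ≤ C * w n) :
    UniformOP μ Set.univ fun n x ω => ((n : ℝ) * w n)⁻¹ * ∑ i : Fin n, φ n x (Z i ω) -
      (w n)⁻¹ * ∫ ω, φ n x (Z 0 ω) ∂μ := by
  obtain ⟨C, hC⟩ := hsq
  intro δ hδ
  have hlim : Tendsto (fun n : ℕ => ENNReal.ofReal (C / δ ^ 2 * ((n : ℝ) * w n)⁻¹)) atTop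
      (𝓝 0) := by
    simpa using ENNReal.tendsto_ofReal ((tendsto_inv_atTop_zero.comp hnw).const_mul (C / δ ^ 2))
  refine .of_le hlim ?_
  filter_upwards [hC, eventually_gt_atTop 0] with n hn hn₀ x _
  have _ : (0 : ℝ) < n := by exact_mod_cast hn₀
  have hwn := hw n
  have hcheb := measure_le_abs_sum_sub_card_mul_integral_le (κ := Fin n)
    (W := fun i ω => φ n x (Z i ω)) (W₀ := fun ω => φ n x (Z 0 ω))
    (fun i j hij => (hindep (Fin.val_ne_of_ne hij)).comp (hφ n x) (hφ n x))
    (fun i => (hident i).comp (hφ n x)) (hmem n x) (c := δ * (n * w n)) (by positivity)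
  simp only [Fintype.card_fin] at hcheb
  refine (measure_mono fun ω hω => ?_).trans (hcheb.trans (ENNReal.ofReal_le_ofReal ?_))
  · have hfactor : ((n : ℝ) * w n)⁻¹ * ∑ i : Fin n, φ n x (Z i ω) -
        (w n)⁻¹ * ∫ ω, φ n x (Z 0 ω) ∂μ =
        (∑ i : Fin n, φ n x (Z i ω) - n * ∫ ω, φ n x (Z 0 ω) ∂μ) / (n * w n) := by field_simp
    rwa [Set.mem_ofPred_eq, hfactor, abs_div, abs_of_pos (by positivity : 0 < (n : ℝ) * w n),
      le_div_iff₀ (by positivity)] at hω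
  · calc (n : ℝ) * (∫ ω, φ n x (Z 0 ω) ^ 2 ∂μ) / (δ * (n * w n)) ^ 2
        ≤ n * (C * w n) / (δ * (n * w n)) ^ 2 := by gcongr; exact hn x
      _ = C / δ ^ 2 * ((n : ℝ) * w n)⁻¹ := by field_simp

end LawOfLargeNumbers

section Design

variable {q : ℕ}

theorem radialExt_coe (g : Sph q → ℝ) (x : Sph q) : radialExt g (x : Amb q) = g x := by
  simp [radialExt, ne_zero_of_mem_unit_sphere x]

theorem continuous_of_contDiffOn_radialExt {g : Sph q → ℝ} {k : WithTop ℕ∞}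
    (hg : ContDiffOn ℝ k (radialExt g) {0}ᶜ) : Continuous g := by
  have hcomp := hg.continuousOn.comp_continuous continuous_subtype_val
    fun x : Sph q => ne_zero_of_mem_unit_sphere x
  exact hcomp.congr (radialExt_coe g)

theorem RegularNoise.continuous {σ : Sph q → ℝ} (hσ : RegularNoise σ) : Continuous σ := by
  have hsqrt : σ = fun x => √(σ x ^ 2) := funext fun x => (Real.sqrt_sq (hσ.nonneg x)).symm
  rw [hsqrt]
  exact hσ.uniformContinuous_sq.continuous.sqrt

end Design

section ConditionalMoments

variable {Ω : Type*} [MeasurableSpace Ω] {μ : Measure Ω}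

theorem integrable_pow_of_memLp_four {W : Ω → ℝ} [IsFiniteMeasure μ] (hW : MemLp W 4 μ) {k : ℕ}
    (hk : k ≤ 4) : Integrable (fun ω => W ω ^ k) μ := by
  have hWk : MemLp W k μ := hW.mono_exponent (by exact_mod_cast hk)
  exact (integrable_norm_iff (hW.aestronglyMeasurable.pow k)).mp
    (by simpa only [Pi.pow_apply, norm_pow] using hWk.integrable_norm_pow')

variable {α : Type*} [TopologicalSpace α] [CompactSpace α] [MeasurableSpace α]
  [OpensMeasurableSpace α] {X : Ω → α} {g : α → ℝ} {W : Ω → ℝ}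

theorem memLp_comp_mul {r : ℝ≥0∞} (hX : Measurable X) (hg : Continuous g) (hW : MemLp W r μ) :
    MemLp (fun ω => g (X ω) * W ω) r μ := by
  obtain ⟨C, -, hC⟩ := exists_abs_le_of_continuous hg
  exact hW.mul' (memLp_top_of_bound (hg.measurable.comp hX).aestronglyMeasurable C
    (ae_of_all _ fun ω => hC (X ω)))

theorem integrable_comp_mul (hX : Measurable X) (hg : Continuous g) (hW : Integrable W μ) :
    Integrable (fun ω => g (X ω) * W ω) μ :=
  memLp_one_iff_integrable.mp (memLp_comp_mul hX hg (memLp_one_iff_integrable.mpr hW))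

variable [IsFiniteMeasure μ]

theorem memLp_comp {r : ℝ≥0∞} (hX : Measurable X) (hg : Continuous g) :
    MemLp (fun ω => g (X ω)) r μ := by
  simpa using memLp_comp_mul hX hg (memLp_const (μ := μ) 1)

theorem integrable_comp (hX : Measurable X) (hg : Continuous g) :
    Integrable (fun ω => g (X ω)) μ :=
  memLp_one_iff_integrable.mp (memLp_comp hX hg)

theorem integral_comp_mul_condExp (hX : Measurable X) (hg : Continuous g) (hW : Integrable W μ) :
    ∫ ω, g (X ω) * (μ[W | MeasurableSpace.comap X inferInstance]) ω ∂μ =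
      ∫ ω, g (X ω) * W ω ∂μ := by
  have hgX : StronglyMeasurable[MeasurableSpace.comap X inferInstance] fun ω => g (X ω) :=
    (hg.measurable.comp (comap_measurable X)).stronglyMeasurable
  have hpull := condExp_mul_of_stronglyMeasurable_left hgX (integrable_comp_mul hX hg hW) hW
  exact (integral_congr_ae hpull).symm.trans (integral_condExp hX.comap_le)

end ConditionalMoments

theorem sq_le_mul_abs_add {κ : ℝ} (hκ : 0 < κ) (t : ℝ) : t ^ 2 ≤ κ * |t| + t ^ 4 / κ ^ 2 := by
  rw [← sq_abs, ← Even.pow_abs (by decide : Even 4)]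
  rcases le_total |t| κ with h | h
  · have : 0 ≤ |t| ^ 4 / κ ^ 2 := by positivity
    nlinarith [abs_nonneg t]
  · have hfour : |t| ^ 2 ≤ |t| ^ 4 / κ ^ 2 := by
      rw [le_div_iff₀ (by positivity)]
      calc |t| ^ 2 * κ ^ 2 ≤ |t| ^ 2 * |t| ^ 2 := by gcongr
        _ = |t| ^ 4 := by ring
    nlinarith [abs_nonneg t]

theorem integral_mul_sq_le {Ω : Type*} [MeasurableSpace Ω] {μ : Measure Ω} {w W : Ω → ℝ}
    (hw : ∀ ω, 0 ≤ w ω) (hint_abs : Integrable (fun ω => w ω * |W ω|) μ)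
    (hint_sq : Integrable (fun ω => w ω * W ω ^ 2) μ)
    (hint_four : Integrable (fun ω => w ω * W ω ^ 4) μ) {κ : ℝ} (hκ : 0 < κ) :
    ∫ ω, w ω * W ω ^ 2 ∂μ ≤ κ * ∫ ω, w ω * |W ω| ∂μ + (∫ ω, w ω * W ω ^ 4 ∂μ) / κ ^ 2 := by
  rw [← integral_const_mul, ← integral_div,
    ← integral_add (hint_abs.const_mul κ) (hint_four.div_const _)]
  refine integral_mono hint_sq ((hint_abs.const_mul κ).add (hint_four.div_const _)) fun ω => ?_
  exact (mul_le_mul_of_nonneg_left (sq_le_mul_abs_add hκ (W ω)) (hw ω)).trans_eq (by ring)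

namespace RegressionModel

variable {q : ℕ} {Ω : Type*} [MeasurableSpace Ω] {μ : Measure Ω}
  {m σ f g : Sph q → ℝ} {X : Ω → Sph q} {Y ε : Ω → ℝ}

theorem integral_design (hM : RegressionModel μ m σ f X Y ε) (hf : Continuous f)
    (hf0 : ∀ x, 0 ≤ f x) (hg : Continuous g) :
    ∫ ω, g (X ω) ∂μ = ∫ y, g y * f y ∂surfaceMeasure q := by
  rw [← integral_map hM.measurable_X.aemeasurable hg.aestronglyMeasurable, hM.density,
    integral_withDensity_eq_integral_toReal_smul hf.measurable.ennreal_ofReal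
      (ae_of_all _ fun _ => ENNReal.ofReal_lt_top)]
  refine integral_congr_ae (ae_of_all _ fun y => ?_)
  simp only [smul_eq_mul]
  rw [ENNReal.toReal_ofReal (hf0 y), mul_comm]

variable [IsProbabilityMeasure μ]

theorem integral_mul_noise (hM : RegressionModel μ m σ f X Y ε) (hg : Continuous g) :
    ∫ ω, g (X ω) * ε ω ∂μ = 0 := by
  rw [← integral_comp_mul_condExp hM.measurable_X hg (hM.memLp_noise.integrable (by norm_num))]
  exact integral_eq_zero_of_ae (hM.condMean.mono fun ω hω => by simp [hω])

theorem integral_mul_noise_sq (hM : RegressionModel μ m σ f X Y ε) (hg : Continuous g) :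
    ∫ ω, g (X ω) * ε ω ^ 2 ∂μ = ∫ ω, g (X ω) ∂μ := by
  rw [← integral_comp_mul_condExp hM.measurable_X hg
    (integrable_pow_of_memLp_four hM.memLp_noise (by norm_num))]
  exact integral_congr_ae (hM.condSq.mono fun ω hω => by simp [hω])

theorem exists_integral_mul_noise_four_le (hM : RegressionModel μ m σ f X Y ε) :
    ∃ C : ℝ, 0 ≤ C ∧ ∀ g : Sph q → ℝ, Continuous g → (∀ x, 0 ≤ g x) →
      ∫ ω, g (X ω) * ε ω ^ 4 ∂μ ≤ C * ∫ ω, g (X ω) ∂μ := by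
  obtain ⟨C, hC⟩ := hM.condFourth
  refine ⟨max C 0, le_max_right _ _, fun g hg hg0 => ?_⟩
  rw [← integral_comp_mul_condExp hM.measurable_X hg
    (integrable_pow_of_memLp_four hM.memLp_noise le_rfl), ← integral_const_mul]
  refine integral_mono_ae (integrable_comp_mul hM.measurable_X hg integrable_condExp)
    ((integrable_comp hM.measurable_X hg).const_mul _) (hC.mono fun ω hω => ?_)
  calc g (X ω) * _ ≤ g (X ω) * max C 0 :=
        mul_le_mul_of_nonneg_left (hω.trans (le_max_left _ _)) (hg0 _)
    _ = max C 0 * g (X ω) := mul_comm _ _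

theorem memLp_response (hM : RegressionModel μ m σ f X Y ε) (hm : Continuous m)
    (hσ : Continuous σ) : MemLp Y 4 μ :=
  ((memLp_comp hM.measurable_X hm).add
    (memLp_comp_mul hM.measurable_X hσ hM.memLp_noise)).ae_eq (hM.model.mono fun _ hω => hω.symm)

theorem integral_mul_response (hM : RegressionModel μ m σ f X Y ε) (hm : Continuous m)
    (hσ : Continuous σ) (hg : Continuous g) :
    ∫ ω, g (X ω) * Y ω ∂μ = ∫ ω, g (X ω) * m (X ω) ∂μ := by
  have hgm : Continuous fun x => g x * m x := hg.mul hm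
  have hgσ : Continuous fun x => g x * σ x := hg.mul hσ
  calc ∫ ω, g (X ω) * Y ω ∂μ
      = ∫ ω, (g (X ω) * m (X ω) + (g (X ω) * σ (X ω)) * ε ω) ∂μ :=
        integral_congr_ae (hM.model.mono fun ω hω => by simp only [hω]; ring)
    _ = ∫ ω, g (X ω) * m (X ω) ∂μ + ∫ ω, (g (X ω) * σ (X ω)) * ε ω ∂μ :=
        integral_add (integrable_comp hM.measurable_X hgm)
          (integrable_comp_mul hM.measurable_X hgσ (hM.memLp_noise.integrable (by norm_num)))
    _ = ∫ ω, g (X ω) * m (X ω) ∂μ := by rw [hM.integral_mul_noise hgσ, add_zero]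

theorem integral_mul_response_sq (hM : RegressionModel μ m σ f X Y ε) (hm : Continuous m)
    (hσ : Continuous σ) (hg : Continuous g) :
    ∫ ω, g (X ω) * Y ω ^ 2 ∂μ = ∫ ω, g (X ω) * (m (X ω) ^ 2 + σ (X ω) ^ 2) ∂μ := by
  have hgm : Continuous fun x => g x * m x ^ 2 := hg.mul (hm.pow 2)
  have hcross : Continuous fun x => 2 * (g x * m x * σ x) :=
    continuous_const.mul ((hg.mul hm).mul hσ)
  have hgσ : Continuous fun x => g x * σ x ^ 2 := hg.mul (hσ.pow 2)
  have hint_m := integrable_comp (μ := μ) hM.measurable_X hgm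
  have hint_cross := integrable_comp_mul hM.measurable_X hcross
    (hM.memLp_noise.integrable (by norm_num))
  have hint_σ := integrable_comp_mul hM.measurable_X hgσ
    (integrable_pow_of_memLp_four hM.memLp_noise (by norm_num : 2 ≤ 4))
  have hint_add : Integrable (fun ω => g (X ω) * m (X ω) ^ 2 +
      2 * (g (X ω) * m (X ω) * σ (X ω)) * ε ω) μ := hint_m.add hint_cross
  calc ∫ ω, g (X ω) * Y ω ^ 2 ∂μ
      = ∫ ω, ((g (X ω) * m (X ω) ^ 2 + 2 * (g (X ω) * m (X ω) * σ (X ω)) * ε ω) +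
          g (X ω) * σ (X ω) ^ 2 * ε ω ^ 2) ∂μ :=
        integral_congr_ae (hM.model.mono fun ω hω => by simp only [hω]; ring)
    _ = ∫ ω, g (X ω) * m (X ω) ^ 2 ∂μ + ∫ ω, 2 * (g (X ω) * m (X ω) * σ (X ω)) * ε ω ∂μ +
          ∫ ω, g (X ω) * σ (X ω) ^ 2 * ε ω ^ 2 ∂μ := by
        rw [integral_add hint_add hint_σ, integral_add hint_m hint_cross]
    _ = ∫ ω, g (X ω) * m (X ω) ^ 2 ∂μ + ∫ ω, g (X ω) * σ (X ω) ^ 2 ∂μ := by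
        rw [hM.integral_mul_noise hcross, hM.integral_mul_noise_sq hgσ, add_zero]
    _ = ∫ ω, g (X ω) * (m (X ω) ^ 2 + σ (X ω) ^ 2) ∂μ := by
        simp only [mul_add]
        exact (integral_add hint_m (integrable_comp hM.measurable_X hgσ)).symm

theorem exists_integral_mul_response_four_le (hM : RegressionModel μ m σ f X Y ε)
    (hm : Continuous m) (hσ : Continuous σ) :
    ∃ C : ℝ, 0 ≤ C ∧ ∀ g : Sph q → ℝ, Continuous g → (∀ x, 0 ≤ g x) →
      ∫ ω, g (X ω) * Y ω ^ 4 ∂μ ≤ C * ∫ ω, g (X ω) ∂μ := by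
  obtain ⟨C, -, hC⟩ := hM.exists_integral_mul_noise_four_le
  have hmσ : Continuous fun x => 8 * (m x ^ 4 + C * σ x ^ 4) := by fun_prop
  obtain ⟨D, hD, hD_le⟩ := exists_abs_le_of_continuous hmσ
  refine ⟨D, hD, fun g hg hg0 => ?_⟩
  have hX := hM.measurable_X
  have hε := integrable_pow_of_memLp_four hM.memLp_noise le_rfl
  have hY := integrable_pow_of_memLp_four (hM.memLp_response hm hσ) le_rfl
  have hgm : Continuous fun x => g x * m x ^ 4 := hg.mul (hm.pow 4)
  have hgσ : Continuous fun x => g x * σ x ^ 4 := hg.mul (hσ.pow 4)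
  have hint_m := integrable_comp (μ := μ) hX hgm
  have hint_σ := integrable_comp (μ := μ) hX hgσ
  calc ∫ ω, g (X ω) * Y ω ^ 4 ∂μ
      ≤ ∫ ω, 8 * (g (X ω) * m (X ω) ^ 4 + g (X ω) * σ (X ω) ^ 4 * ε ω ^ 4) ∂μ := by
        refine integral_mono_ae (integrable_comp_mul hX hg hY)
          ((hint_m.add (integrable_comp_mul hX hgσ hε)).const_mul 8) (hM.model.mono fun ω hω => ?_)
        have hconv := (by decide : Even 4).add_pow_le (a := m (X ω)) (b := σ (X ω) * ε ω)
        norm_num only at hconv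
        rw [mul_pow] at hconv
        simp only [hω]
        nlinarith [mul_le_mul_of_nonneg_left hconv (hg0 (X ω))]
    _ = 8 * (∫ ω, g (X ω) * m (X ω) ^ 4 ∂μ + ∫ ω, g (X ω) * σ (X ω) ^ 4 * ε ω ^ 4 ∂μ) := by
        rw [integral_const_mul, integral_add hint_m (integrable_comp_mul hX hgσ hε)]
    _ ≤ 8 * (∫ ω, g (X ω) * m (X ω) ^ 4 ∂μ + C * ∫ ω, g (X ω) * σ (X ω) ^ 4 ∂μ) := by
        gcongr
        exact hC _ hgσ fun x => mul_nonneg (hg0 x) (by positivity)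
    _ = ∫ ω, 8 * (m (X ω) ^ 4 + C * σ (X ω) ^ 4) * g (X ω) ∂μ := by
        rw [← integral_const_mul, ← integral_add hint_m (hint_σ.const_mul C), ← integral_const_mul]
        exact integral_congr_ae (ae_of_all _ fun ω => by ring)
    _ ≤ D * ∫ ω, g (X ω) ∂μ := by
        rw [← integral_const_mul]
        exact integral_mono (integrable_comp hX (hmσ.mul hg))
          ((integrable_comp hX hg).const_mul D) fun ω =>
            mul_le_mul_of_nonneg_right ((le_abs_self _).trans (hD_le _)) (hg0 _)

theorem mul_integral_le_integral_mul_response_sq (hM : RegressionModel μ m σ f X Y ε)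
    (hm : Continuous m) (hσ : Continuous σ) {s : ℝ} (hlower : ∀ x, s ≤ m x ^ 2 + σ x ^ 2)
    (hg : Continuous g) (hg0 : ∀ x, 0 ≤ g x) :
    s * ∫ ω, g (X ω) ∂μ ≤ ∫ ω, g (X ω) * Y ω ^ 2 ∂μ := by
  have hint := integrable_comp (μ := μ) hM.measurable_X hg
  rw [hM.integral_mul_response_sq hm hσ hg, ← integral_const_mul]
  refine integral_mono (hint.const_mul s) (integrable_comp hM.measurable_X
    (hg.mul ((hm.pow 2).add (hσ.pow 2)))) fun ω => ?_
  exact (mul_comm _ _).trans_le (mul_le_mul_of_nonneg_left (hlower _) (hg0 _))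

/-- Since the conditional second moment of `Y` is at least `s` and the fourth one is bounded, the
conditional first absolute moment cannot be small. -/
theorem exists_le_integral_mul_abs_response (hM : RegressionModel μ m σ f X Y ε)
    (hm : Continuous m) (hσ : Continuous σ) {s : ℝ} (hs : 0 < s)
    (hlower : ∀ x, s ≤ m x ^ 2 + σ x ^ 2) :
    ∃ c : ℝ, 0 < c ∧ ∀ g : Sph q → ℝ, Continuous g → (∀ x, 0 ≤ g x) →
      c * ∫ ω, g (X ω) ∂μ ≤ ∫ ω, g (X ω) * |Y ω| ∂μ := by
  obtain ⟨C, hC, hfour⟩ := hM.exists_integral_mul_response_four_le hm hσ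
  set κ : ℝ := √(2 * (C + 1) / s)
  have hκ : 0 < κ := Real.sqrt_pos.mpr (by positivity)
  have hκ_sq : κ ^ 2 = 2 * (C + 1) / s := Real.sq_sqrt (by positivity)
  have hCκ : C / κ ^ 2 ≤ s / 2 := by
    rw [hκ_sq, div_le_iff₀ (by positivity)]
    field_simp
    linarith
  refine ⟨s / (2 * κ), by positivity, fun g hg hg0 => ?_⟩
  have hX := hM.measurable_X
  have hY := hM.memLp_response hm hσ
  have hsecond := hM.mul_integral_le_integral_mul_response_sq hm hσ hlower hg hg0
  have htrunc := integral_mul_sq_le (fun ω => hg0 (X ω))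
    (integrable_comp_mul hX hg (hY.integrable (by norm_num)).abs)
    (integrable_comp_mul hX hg (integrable_pow_of_memLp_four hY (by norm_num : 2 ≤ 4)))
    (integrable_comp_mul hX hg (integrable_pow_of_memLp_four hY le_rfl)) hκ
  have hsmall : (∫ ω, g (X ω) * Y ω ^ 4 ∂μ) / κ ^ 2 ≤ s / 2 * ∫ ω, g (X ω) ∂μ :=
    calc (∫ ω, g (X ω) * Y ω ^ 4 ∂μ) / κ ^ 2 ≤ C * (∫ ω, g (X ω) ∂μ) / κ ^ 2 := by
          gcongr; exact hfour g hg hg0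
      _ = C / κ ^ 2 * ∫ ω, g (X ω) ∂μ := by ring
      _ ≤ s / 2 * ∫ ω, g (X ω) ∂μ :=
          mul_le_mul_of_nonneg_right hCκ (integral_nonneg fun _ => hg0 _)
  calc s / (2 * κ) * ∫ ω, g (X ω) ∂μ = (s / 2 * ∫ ω, g (X ω) ∂μ) / κ := by ring
    _ ≤ ∫ ω, g (X ω) * |Y ω| ∂μ := by rw [div_le_iff₀ hκ]; linarith

end RegressionModel

section LocalAverages

variable {q : ℕ} {Ω : Type*} [MeasurableSpace Ω]

/-- A pairwise independent, identically distributed sample from a regression model in which `m`,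
`σ` and `f` are merely continuous, `f` is positive and the response does not degenerate to `0`,
together with the kernel, the bandwidths and the projection matrices used to estimate `m`. -/
structure SamplingScheme (μ : Measure Ω) (m σ f : Sph q → ℝ) (L : ℝ → ℝ) (h : ℕ → ℝ)
    (X : ℕ → Ω → Sph q) (Y ε : ℕ → Ω → ℝ) (B : Sph q → Matrix (Fin (q + 1)) (Fin q) ℝ) :
    Prop where
  one_le : 1 ≤ q
  projection : ∀ x, IsProjectionMatrix x (B x)
  model : ∀ i, RegressionModel μ m σ f (X i) (Y i) (ε i)
  indep : Pairwise fun i j => IndepFun (fun ω => (X i ω, Y i ω)) (fun ω => (X j ω, Y j ω)) μ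
  ident : ∀ i, IdentDistrib (fun ω => (X i ω, Y i ω)) (fun ω => (X 0 ω, Y 0 ω)) μ μ
  continuous_m : Continuous m
  continuous_σ : Continuous σ
  continuous_f : Continuous f
  f_pos : ∀ x, 0 < f x
  nondegenerate : ∀ x, m x ≠ 0 ∨ σ x ≠ 0
  kernel : IsDirectionalKernel L
  bandwidth : IsBandwidth q h

/-- The average of `W (Y_i)` over the sample with weights `localKernel`, scaled by `h ^ q`. -/
def localAverage (L : ℝ → ℝ) (ψ : EuclideanSpace ℝ (Fin q) → ℝ) (W : ℝ → ℝ) (h : ℕ → ℝ)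
    (X : ℕ → Ω → Sph q) (Y : ℕ → Ω → ℝ) (B : Sph q → Matrix (Fin (q + 1)) (Fin q) ℝ)
    (n : ℕ) (x : Sph q) (ω : Ω) : ℝ :=
  ((n : ℝ) * h n ^ q)⁻¹ * ∑ i : Fin n, localKernel L ψ (h n) x (B x) (X i ω) * W (Y i ω)

theorem exists_pos_forall_le_of_continuous {α : Type*} [TopologicalSpace α] [CompactSpace α]
    {G : α → ℝ} (hG : Continuous G) (hpos : ∀ y, 0 < G y) : ∃ c : ℝ, 0 < c ∧ ∀ y, c ≤ G y := by
  obtain ⟨c, hc, hle⟩ := isCompact_univ.exists_forall_le' hG.continuousOn fun y _ => hpos y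
  exact ⟨c, hc, fun y => hle y trivial⟩

theorem IsBandwidth.tendsto_nhdsGT {h : ℕ → ℝ} (hh : IsBandwidth q h) :
    Tendsto h atTop (𝓝[>] 0) :=
  tendsto_nhdsWithin_iff.mpr ⟨hh.tendsto_zero, Eventually.of_forall hh.pos⟩

namespace SamplingScheme

variable {μ : Measure Ω} {m σ f : Sph q → ℝ} {L : ℝ → ℝ} {h : ℕ → ℝ}
  {X : ℕ → Ω → Sph q} {Y ε : ℕ → Ω → ℝ} {B : Sph q → Matrix (Fin (q + 1)) (Fin q) ℝ}
  {ψ : EuclideanSpace ℝ (Fin q) → ℝ} {G : Sph q → ℝ}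

theorem integral_localKernel (H : SamplingScheme μ m σ f L h X Y ε B) (hψ : ModerateGrowth ψ)
    (hG : Continuous G) (n : ℕ) (x : Sph q) :
    ∫ ω, localKernel L ψ (h n) x (B x) (X 0 ω) * G (X 0 ω) ∂μ =
      localIntegral L ψ (fun y => G y * f y) (h n) x (B x) := by
  have hcont : Continuous fun y => localKernel L ψ (h n) x (B x) y * G y :=
    (continuous_localKernel H.kernel hψ.continuous (h n) x (B x)).mul hG
  rw [(H.model 0).integral_design H.continuous_f (fun x => (H.f_pos x).le) hcont]
  simp only [localIntegral, mul_assoc]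

theorem tendstoUniformly_integral_localKernel (H : SamplingScheme μ m σ f L h X Y ε B)
    (hψ : ModerateGrowth ψ) (hG : Continuous G) :
    TendstoUniformly
      (fun n x => (h n ^ q)⁻¹ * ∫ ω, localKernel L ψ (h n) x (B x) (X 0 ω) * G (X 0 ω) ∂μ)
      (fun x => G x * f x * kernelMoment L ψ) atTop := by
  simp only [H.integral_localKernel hψ hG]
  exact fun u hu => H.bandwidth.tendsto_nhdsGT.eventually
    (tendstoUniformly_localIntegral H.kernel hψ (hG.mul H.continuous_f) H.projection u hu)

theorem exists_integral_localKernel_sq_le (H : SamplingScheme μ m σ f L h X Y ε B)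
    (hψ : ModerateGrowth ψ) (hG : Continuous G) :
    ∃ C : ℝ, ∀ᶠ n in atTop, ∀ x,
      ∫ ω, localKernel L ψ (h n) x (B x) (X 0 ω) ^ 2 * G (X 0 ω) ∂μ ≤ C * h n ^ q := by
  obtain ⟨C, hC⟩ := eventually_localIntegral_le H.kernel.sq (hψ.mul hψ) (hG.mul H.continuous_f)
    H.projection
  refine ⟨C, (H.bandwidth.tendsto_nhdsGT.eventually hC).mono fun n hn x => ?_⟩
  have hcont : Continuous fun y => localKernel L ψ (h n) x (B x) y ^ 2 * G y :=
    ((continuous_localKernel H.kernel hψ.continuous (h n) x (B x)).pow 2).mul hG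
  rw [(H.model 0).integral_design H.continuous_f (fun x => (H.f_pos x).le) hcont]
  refine (integral_congr_ae (ae_of_all _ fun y => ?_)).trans_le (hn x)
  simp only [localKernel, Pi.mul_apply]
  ring

variable [IsProbabilityMeasure μ]

theorem memLp_response (H : SamplingScheme μ m σ f L h X Y ε B) : MemLp (Y 0) 4 μ :=
  (H.model 0).memLp_response H.continuous_m H.continuous_σ

theorem integrable_sq_comp_response (H : SamplingScheme μ m σ f L h X Y ε B) {W : ℝ → ℝ}
    (hW : Measurable W) (hW_sq : ∀ t, W t ^ 2 ≤ 1 + t ^ 2) :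
    Integrable (fun ω => W (Y 0 ω) ^ 2) μ :=
  ((integrable_const 1).add (integrable_pow_of_memLp_four H.memLp_response (by norm_num))).mono'
    ((hW.comp (H.model 0).measurable_Y).pow_const 2).aestronglyMeasurable
    (ae_of_all _ fun ω => (Real.norm_of_nonneg (sq_nonneg _)).trans_le (hW_sq _))

theorem exists_integral_sq_localKernel_mul_le (H : SamplingScheme μ m σ f L h X Y ε B)
    (hψ : ModerateGrowth ψ) {W : ℝ → ℝ} (hW : Measurable W) (hW_sq : ∀ t, W t ^ 2 ≤ 1 + t ^ 2) :
    ∃ C : ℝ, ∀ᶠ n in atTop, ∀ x,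
      ∫ ω, (localKernel L ψ (h n) x (B x) (X 0 ω) * W (Y 0 ω)) ^ 2 ∂μ ≤ C * h n ^ q := by
  have hX := (H.model 0).measurable_X
  have hmσ : Continuous fun x => m x ^ 2 + σ x ^ 2 :=
    (H.continuous_m.pow 2).add (H.continuous_σ.pow 2)
  obtain ⟨C, hC⟩ := H.exists_integral_localKernel_sq_le hψ (continuous_const (y := 1) |>.add hmσ)
  refine ⟨C, hC.mono fun n hn x => le_trans ?_ (hn x)⟩
  have hK_sq : Continuous fun y => localKernel L ψ (h n) x (B x) y ^ 2 :=
    (continuous_localKernel H.kernel hψ.continuous _ _ _).pow 2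
  have hint := integrable_comp (μ := μ) hX hK_sq
  have hint_sq := integrable_comp_mul hX hK_sq
    (integrable_pow_of_memLp_four H.memLp_response (by norm_num : 2 ≤ 4))
  have hint_mσ := integrable_comp (μ := μ) hX (hK_sq.mul hmσ)
  calc ∫ ω, (localKernel L ψ (h n) x (B x) (X 0 ω) * W (Y 0 ω)) ^ 2 ∂μ
      ≤ ∫ ω, (localKernel L ψ (h n) x (B x) (X 0 ω) ^ 2 +
          localKernel L ψ (h n) x (B x) (X 0 ω) ^ 2 * Y 0 ω ^ 2) ∂μ := by
        simp only [mul_pow]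
        refine integral_mono (integrable_comp_mul hX hK_sq
          (H.integrable_sq_comp_response hW hW_sq)) (hint.add hint_sq) fun ω => ?_
        exact (mul_le_mul_of_nonneg_left (hW_sq _) (sq_nonneg _)).trans_eq (by ring)
    _ = ∫ ω, localKernel L ψ (h n) x (B x) (X 0 ω) ^ 2 *
          (1 + (m (X 0 ω) ^ 2 + σ (X 0 ω) ^ 2)) ∂μ := by
        simp only [mul_add (_ ^ 2) (1 : ℝ), mul_one]
        rw [integral_add hint hint_sq, (H.model 0).integral_mul_response_sq H.continuous_m
          H.continuous_σ hK_sq]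
        exact (integral_add hint hint_mσ).symm

theorem uniformOP_localAverage_sub_mean (H : SamplingScheme μ m σ f L h X Y ε B)
    (hψ : ModerateGrowth ψ) {W : ℝ → ℝ} (hW : Measurable W) (hW_sq : ∀ t, W t ^ 2 ≤ 1 + t ^ 2) :
    UniformOP μ Set.univ fun n x ω => localAverage L ψ W h X Y B n x ω -
      (h n ^ q)⁻¹ * ∫ ω, localKernel L ψ (h n) x (B x) (X 0 ω) * W (Y 0 ω) ∂μ := by
  have hK (n : ℕ) (x : Sph q) : Continuous (localKernel L ψ (h n) x (B x)) :=
    continuous_localKernel H.kernel hψ.continuous _ _ _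
  have hWY : MemLp (fun ω => W (Y 0 ω)) 2 μ :=
    (memLp_two_iff_integrable_sq (hW.comp (H.model 0).measurable_Y).aestronglyMeasurable).mpr
      (H.integrable_sq_comp_response hW hW_sq)
  exact uniformOP_average H.indep H.ident
    (φ := fun n x z => localKernel L ψ (h n) x (B x) z.1 * W z.2)
    (fun n x => ((hK n x).measurable.comp measurable_fst).mul (hW.comp measurable_snd))
    (fun n => pow_pos (H.bandwidth.pos n) q) H.bandwidth.tendsto_mul
    (fun n x => memLp_comp_mul (H.model 0).measurable_X (hK n x) hWY)
    (H.exists_integral_sq_localKernel_mul_le hψ hW hW_sq)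

theorem uniformOP_localAverage_one (H : SamplingScheme μ m σ f L h X Y ε B)
    (hψ : ModerateGrowth ψ) :
    UniformOP μ Set.univ fun n x ω => localAverage L ψ (fun _ => 1) h X Y B n x ω -
      f x * kernelMoment L ψ := by
  have hmean := H.tendstoUniformly_integral_localKernel hψ (continuous_const (y := (1 : ℝ)))
  have hsum := (H.uniformOP_localAverage_sub_mean hψ (measurable_const (a := (1 : ℝ)))
    fun t => by nlinarith [sq_nonneg t]).add_deterministic hmean
  simpa only [sub_add_sub_cancel, one_mul] using hsum

theorem uniformOP_localAverage_id (H : SamplingScheme μ m σ f L h X Y ε B)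
    (hψ : ModerateGrowth ψ) :
    UniformOP μ Set.univ fun n x ω => localAverage L ψ id h X Y B n x ω -
      m x * f x * kernelMoment L ψ := by
  have hmean := H.tendstoUniformly_integral_localKernel hψ H.continuous_m
  have hsum := (H.uniformOP_localAverage_sub_mean hψ measurable_id
    fun t => by simp).add_deterministic hmean
  simp only [id_eq, (H.model 0).integral_mul_response H.continuous_m H.continuous_σ
    (continuous_localKernel H.kernel hψ.continuous _ _ _), sub_add_sub_cancel] at hsum
  exact hsum

theorem exists_le_integral_localKernel_mul_abs (H : SamplingScheme μ m σ f L h X Y ε B) :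
    ∃ c : ℝ, 0 < c ∧ ∀ᶠ n in atTop, ∀ x, c ≤
      (h n ^ q)⁻¹ * ∫ ω, localKernel L (fun _ => 1) (h n) x (B x) (X 0 ω) * |Y 0 ω| ∂μ := by
  obtain ⟨s, hs, hs_le⟩ := exists_pos_forall_le_of_continuous
    ((H.continuous_m.pow 2).add (H.continuous_σ.pow 2)) fun x => by
      simp only [Pi.add_apply, Pi.pow_apply]
      rcases H.nondegenerate x with hx | hx <;> positivity
  obtain ⟨d, hd, hd_le⟩ := exists_pos_forall_le_of_continuous H.continuous_f H.f_pos
  obtain ⟨c, hc, hc_le⟩ := (H.model 0).exists_le_integral_mul_abs_response H.continuous_m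
    H.continuous_σ hs hs_le
  have hmass : 0 < kernelMass q L := kernelMass_pos H.one_le H.kernel
  refine ⟨c * (d * kernelMass q L / 2), by positivity, ?_⟩
  have hunif := H.tendstoUniformly_integral_localKernel (ModerateGrowth.const 1)
    (continuous_const (y := (1 : ℝ)))
  filter_upwards [Metric.tendstoUniformly_iff.mp hunif (d * kernelMass q L / 2) (by positivity)]
    with n hn x
  have hhq : 0 < h n ^ q := pow_pos (H.bandwidth.pos n) q
  set K := localKernel L (fun _ => 1) (h n) x (B x)
  have hK : Continuous K := continuous_localKernel H.kernel continuous_const _ _ _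
  have hK0 (y : Sph q) : 0 ≤ K y := mul_nonneg
    (H.kernel.nonneg _ (div_nonneg (one_sub_inner_nonneg x y) (sq_nonneg (h n)))) zero_le_one
  have hmean : d * kernelMass q L / 2 ≤ (h n ^ q)⁻¹ * ∫ ω, K (X 0 ω) ∂μ := by
    have hdist := hn x
    simp only [mul_one, one_mul] at hdist
    rw [dist_comm, Real.dist_eq, kernelMoment_one H.one_le] at hdist
    linarith [(abs_lt.mp hdist).1, mul_le_mul_of_nonneg_right (hd_le x) hmass.le]
  calc c * (d * kernelMass q L / 2) ≤ c * ((h n ^ q)⁻¹ * ∫ ω, K (X 0 ω) ∂μ) := by gcongr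
    _ = (h n ^ q)⁻¹ * (c * ∫ ω, K (X 0 ω) ∂μ) := by ring
    _ ≤ (h n ^ q)⁻¹ * ∫ ω, K (X 0 ω) * |Y 0 ω| ∂μ := by gcongr; exact hc_le K hK hK0

theorem exists_negligible_localAverage_abs_lt (H : SamplingScheme μ m σ f L h X Y ε B) :
    ∃ c : ℝ, 0 < c ∧ UniformlyNegligible μ Set.univ fun n x =>
      {ω | localAverage L (fun _ => 1) (|·|) h X Y B n x ω < c} := by
  obtain ⟨c, hc, hlow⟩ := H.exists_le_integral_localKernel_mul_abs
  have hcentred := H.uniformOP_localAverage_sub_mean (ModerateGrowth.const 1) (W := (|·|))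
    (by fun_prop) fun t => by simp
  refine ⟨c / 2, by positivity, (hcentred (c / 2) (by positivity)).mono ?_⟩
  filter_upwards [hlow] with n hn x _ ω
    (hω : localAverage L (fun _ => 1) (|·|) h X Y B n x ω < c / 2)
  rw [Set.mem_ofPred_eq, abs_sub_comm]
  exact le_trans (by linarith [hn x]) (le_abs_self _)

end SamplingScheme

end LocalAverages

section MatrixInverse

variable {κ : Type*} [Fintype κ] [DecidableEq κ]

theorem continuousAt_inv_mulVec {α : Type*} [TopologicalSpace α] {N : α → Matrix κ κ ℝ}
    {T : α → κ → ℝ} {z : α} (hN : ContinuousAt N z) (hT : ContinuousAt T z)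
    (hz : (N z).det ≠ 0) : ContinuousAt (fun z => (N z)⁻¹ *ᵥ T z) z := by
  have hdet : ContinuousAt (fun z => (N z).det) z :=
    continuous_id.matrix_det.continuousAt.comp hN
  have hadj : ContinuousAt (fun z => (N z).adjugate) z :=
    continuous_id.matrix_adjugate.continuousAt.comp hN
  have hmulVec : Continuous fun P : Matrix κ κ ℝ × (κ → ℝ) => P.1 *ᵥ P.2 :=
    continuous_fst.matrix_mulVec continuous_snd
  simp only [Matrix.inv_def, Ring.inverse_eq_inv']
  exact hmulVec.continuousAt.comp (((hdet.inv₀ hz).smul hadj).prodMk hT)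

theorem measurable_inv_apply {Ω : Type*} [MeasurableSpace Ω] {N : Ω → Matrix κ κ ℝ}
    (hN : ∀ a b, Measurable fun ω => N ω a b) (a b : κ) : Measurable fun ω => (N ω)⁻¹ a b := by
  have hN' : Measurable fun ω c d => N ω c d :=
    measurable_pi_lambda _ fun c => measurable_pi_lambda _ fun d => hN c d
  have hdet : Continuous fun A : κ → κ → ℝ => (Matrix.of A).det :=
    Continuous.matrix_det continuous_id
  have hadj : Continuous fun A : κ → κ → ℝ => (Matrix.of A).adjugate a b :=
    (Continuous.matrix_adjugate continuous_id).matrix_elem a b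
  simp only [Matrix.inv_def, Ring.inverse_eq_inv', Matrix.smul_apply]
  exact (hdet.measurable.comp hN').inv.smul (hadj.measurable.comp hN')

end MatrixInverse

section Estimator

variable {q n p : ℕ}

/-- The factors by which the columns of the design matrix differ from the regressors, which are
evaluated at tangent coordinates in units of the bandwidth. -/
def columnScale (p q : ℕ) (h : ℝ) (a : Unit ⊕ (Fin p × Fin q)) : ℝ :=
  Sum.elim (fun _ => 1) (fun _ => h) a

theorem columnScale_ne_zero {h : ℝ} (hh : h ≠ 0) (a : Unit ⊕ (Fin p × Fin q)) :
    columnScale p q h a ≠ 0 := by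
  rcases a with - | -
  · exact one_ne_zero
  · exact hh

/-- The matrix `𝒳ᵀ 𝒲 𝒳`, normalised so that it converges. -/
def scaledNormalMatrix (p : ℕ) (L : ℝ → ℝ) (h : ℝ) (B : Matrix (Fin (q + 1)) (Fin q) ℝ)
    (x : Sph q) (X : Fin n → Sph q) : Matrix (Unit ⊕ (Fin p × Fin q)) (Unit ⊕ (Fin p × Fin q)) ℝ :=
  Matrix.of fun a b => ((n : ℝ) * h ^ q)⁻¹ *
    ∑ i, localKernel L (fun u => regressor p a u * regressor p b u) h x B (X i)

/-- The vector `𝒳ᵀ 𝒲 Y`, normalised so that it converges. -/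
def scaledMoments (p : ℕ) (L : ℝ → ℝ) (h : ℝ) (B : Matrix (Fin (q + 1)) (Fin q) ℝ) (x : Sph q)
    (X : Fin n → Sph q) (Y : Fin n → ℝ) (a : Unit ⊕ (Fin p × Fin q)) : ℝ :=
  ((n : ℝ) * h ^ q)⁻¹ * ∑ i, localKernel L (regressor p a) h x B (X i) * Y i

/-- The estimator with the weights of `equivKernel`. -/
def equivEstimator (L : ℝ → ℝ) (f : Sph q → ℝ) (h : ℝ) (x : Sph q) (X : Fin n → Sph q)
    (Y : Fin n → ℝ) : ℝ :=
  ∑ i, equivKernel L f n h x (X i) * Y i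

variable {L : ℝ → ℝ} {f : Sph q → ℝ} {h : ℝ} {x : Sph q} {B : Matrix (Fin (q + 1)) (Fin q) ℝ}

theorem designMatrix_apply (hB : IsProjectionMatrix x B) (hh : h ≠ 0) (X : Fin n → Sph q)
    (i : Fin n) (a : Unit ⊕ (Fin p × Fin q)) :
    designMatrix p B x X i a =
      columnScale p q h a * regressor p a (h⁻¹ • tangentCoord B (X i : Amb q)) := by
  rcases a with - | ⟨k, j⟩
  · simp [designMatrix, columnScale, regressor]
  · have hcoord : designMatrix p B x X i (Sum.inr (k, j)) =
        tangentCoord B ((X i : Amb q) - (x : Amb q)) j := rfl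
    rw [hcoord, map_sub, hB.tangentCoord_self, sub_zero]
    simp [columnScale, regressor, hh]

theorem normalMatrix_eq (hB : IsProjectionMatrix x B) (hh : 0 < h) (hn : n ≠ 0)
    (X : Fin n → Sph q) :
    normalMatrix p L h B x X =
      Matrix.diagonal (fun a => (n / kernelMassAt q L h) * columnScale p q h a) *
        scaledNormalMatrix p L h B x X * Matrix.diagonal (columnScale p q h) := by
  have hn' : (n : ℝ) ≠ 0 := by exact_mod_cast hn
  ext a b
  rw [Matrix.mul_diagonal, Matrix.diagonal_mul, normalMatrix, weightMatrix, Matrix.mul_apply]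
  simp only [Matrix.mul_diagonal, Matrix.transpose_apply, designMatrix_apply hB hh.ne',
    scaledNormalMatrix, Matrix.of_apply, Finset.mul_sum, Finset.sum_mul]
  refine Finset.sum_congr rfl fun i _ => ?_
  simp only [dirKernel, localKernel, mul_inv]
  field_simp

theorem transpose_designMatrix_mul_weightMatrix_mulVec (hB : IsProjectionMatrix x B) (hh : 0 < h)
    (hn : n ≠ 0) (X : Fin n → Sph q) (Y : Fin n → ℝ) :
    ((designMatrix p B x X)ᵀ * weightMatrix L h x X) *ᵥ Y =
      Matrix.diagonal (fun a => (n / kernelMassAt q L h) * columnScale p q h a) *ᵥ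
        scaledMoments p L h B x X Y := by
  have hn' : (n : ℝ) ≠ 0 := by exact_mod_cast hn
  ext a
  rw [Matrix.mulVec_diagonal, Matrix.mulVec, dotProduct, weightMatrix]
  simp only [Matrix.mul_diagonal, Matrix.transpose_apply, designMatrix_apply hB hh.ne',
    scaledMoments, Finset.mul_sum]
  refine Finset.sum_congr rfl fun i _ => ?_
  simp only [dirKernel, localKernel, mul_inv]
  field_simp

theorem isUnit_det_diagonal_columnScale {c : ℝ} (hc : c ≠ 0) (hh : h ≠ 0) :
    IsUnit (Matrix.diagonal fun a => c * columnScale p q h a).det := by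
  rw [Matrix.det_diagonal, isUnit_iff_ne_zero]
  exact Finset.prod_ne_zero_iff.mpr fun a _ => mul_ne_zero hc (columnScale_ne_zero hh a)

theorem localEstimator_eq_inv_mulVec (hB : IsProjectionMatrix x B) (hh : 0 < h) (hn : n ≠ 0)
    (hmass : kernelMassAt q L h ≠ 0) (X : Fin n → Sph q) (Y : Fin n → ℝ) :
    localEstimator p L h B x X Y =
      ((scaledNormalMatrix p L h B x X)⁻¹ *ᵥ scaledMoments p L h B x X Y) (Sum.inl ()) := by
  have hrow := isUnit_det_diagonal_columnScale (p := p) (q := q)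
    (div_ne_zero (Nat.cast_ne_zero.mpr hn) hmass) hh.ne'
  have hcol := isUnit_det_diagonal_columnScale (p := p) (q := q) one_ne_zero hh.ne'
  simp only [one_mul] at hcol
  set S := Matrix.diagonal (columnScale p q h)
  set z := (scaledNormalMatrix p L h B x X)⁻¹ *ᵥ scaledMoments p L h B x X Y
  calc localEstimator p L h B x X Y = (S⁻¹ *ᵥ z) (Sum.inl ()) := by
        rw [localEstimator, Matrix.mul_assoc, ← Matrix.mulVec_mulVec,
          transpose_designMatrix_mul_weightMatrix_mulVec hB hh hn, normalMatrix_eq hB hh hn,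
          Matrix.mul_inv_rev, Matrix.mul_inv_rev, Matrix.mulVec_mulVec, Matrix.mul_assoc,
          Matrix.mul_assoc, Matrix.nonsing_inv_mul _ hrow, Matrix.mul_one, ← Matrix.mulVec_mulVec]
    _ = (S *ᵥ S⁻¹ *ᵥ z) (Sum.inl ()) := by
        rw [Matrix.mulVec_diagonal]
        exact (one_mul _).symm
    _ = z (Sum.inl ()) := by rw [Matrix.mulVec_mulVec, Matrix.mul_nonsing_inv _ hcol,
        Matrix.one_mulVec]

theorem localEstimator_zero_eq_div (hB : IsProjectionMatrix x B) (hh : 0 < h) (hn : n ≠ 0)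
    (hmass : kernelMassAt q L h ≠ 0) (X : Fin n → Sph q) (Y : Fin n → ℝ) :
    localEstimator 0 L h B x X Y =
      (∑ i, localKernel L (fun _ => 1) h x B (X i) * Y i) /
        ∑ i, localKernel L (fun _ => 1) h x B (X i) := by
  have hscale : ((n : ℝ) * h ^ q)⁻¹ ≠ 0 :=
    inv_ne_zero (mul_ne_zero (Nat.cast_ne_zero.mpr hn) (pow_pos hh q).ne')
  have : Unique (Unit ⊕ (Fin 0 × Fin q)) := Equiv.sumEmpty Unit (Fin 0 × Fin q) |>.unique
  rw [localEstimator_eq_inv_mulVec hB hh hn hmass, Matrix.inv_subsingleton, Matrix.mulVec_diagonal,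
    Ring.inverse_eq_inv', inv_mul_eq_div]
  simp only [scaledNormalMatrix, scaledMoments, Matrix.of_apply, regressor, Sum.elim_inl, mul_one]
  rw [mul_div_mul_left _ _ hscale]
  rfl

theorem isUnit_det_normalMatrix (hB : IsProjectionMatrix x B) (hh : 0 < h) (hn : n ≠ 0)
    (hmass : kernelMassAt q L h ≠ 0) (X : Fin n → Sph q)
    (hdet : (scaledNormalMatrix p L h B x X).det ≠ 0) :
    IsUnit (normalMatrix p L h B x X).det := by
  have hrow := isUnit_det_diagonal_columnScale (p := p) (q := q)
    (div_ne_zero (Nat.cast_ne_zero.mpr hn) hmass) hh.ne'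
  have hcol := isUnit_det_diagonal_columnScale (p := p) (q := q) one_ne_zero hh.ne'
  simp only [one_mul] at hcol
  rw [normalMatrix_eq hB hh hn, Matrix.det_mul, Matrix.det_mul]
  exact (hrow.mul (isUnit_iff_ne_zero.mpr hdet)).mul hcol

theorem equivEstimator_eq_div (X : Fin n → Sph q) (Y : Fin n → ℝ) :
    equivEstimator L f h x X Y =
      (((n : ℝ) * h ^ q)⁻¹ * ∑ i, localKernel L (fun _ => 1) h x B (X i) * Y i) /
        (kernelMass q L * f x) := by
  simp only [equivEstimator, Finset.mul_sum, Finset.sum_div]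
  refine Finset.sum_congr rfl fun i _ => ?_
  simp only [equivKernel, localKernel, mul_inv, div_eq_mul_inv]
  ring

theorem localWeight_mul_eq_zero {X : Fin n → Sph q} {Y : Fin n → ℝ} {i : Fin n}
    (hi : L ((1 - inner ℝ (x : Amb q) (X i : Amb q)) / h ^ 2) * Y i = 0) :
    localWeight p L h B x X i * Y i = 0 := by
  rw [localWeight, weightMatrix, Matrix.mul_diagonal, dirKernel, mul_assoc, mul_assoc, hi,
    mul_zero, mul_zero]

section Measurability

variable {Ω : Type*} [MeasurableSpace Ω] {X : Fin n → Ω → Sph q} {Y : Fin n → Ω → ℝ}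

theorem measurable_localEstimator (hL : IsDirectionalKernel L) (hX : ∀ i, Measurable (X i))
    (hY : ∀ i, Measurable (Y i)) :
    Measurable fun ω => localEstimator p L h B x (fun i => X i ω) (fun i => Y i ω) := by
  have hdesign (i : Fin n) (a : Unit ⊕ (Fin p × Fin q)) :
      Measurable fun ω => designMatrix p B x (fun i => X i ω) i a := by
    rcases a with - | ⟨-, j⟩
    · exact measurable_const
    · have hcoord : Continuous fun y : Sph q => tangentCoord B ((y : Amb q) - (x : Amb q)) j := by
        fun_prop
      exact hcoord.measurable.comp (hX i)
  have hweight (i : Fin n) : Measurable fun ω => dirKernel L h x (X i ω) :=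
    ((hL.continuous_sphere h x).measurable.comp (hX i)).const_mul _
  have hnormal (a b : Unit ⊕ (Fin p × Fin q)) :
      Measurable fun ω => normalMatrix p L h B x (fun i => X i ω) a b := by
    simp only [normalMatrix, weightMatrix, Matrix.mul_apply (M := _ * _), Matrix.mul_diagonal,
      Matrix.transpose_apply]
    exact Finset.measurable_fun_sum _ fun i _ => ((hdesign i a).mul (hweight i)).mul (hdesign i b)
  simp only [localEstimator_eq_sum, localWeight, weightMatrix, Matrix.mul_diagonal]
  simp only [Matrix.mul_apply, Matrix.transpose_apply]
  exact Finset.measurable_fun_sum _ fun i _ =>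
    ((Finset.measurable_fun_sum _ fun a _ =>
      (measurable_inv_apply hnormal _ a).mul (hdesign i a)).mul (hweight i)).mul (hY i)

theorem measurable_equivEstimator (hL : IsDirectionalKernel L) (hX : ∀ i, Measurable (X i))
    (hY : ∀ i, Measurable (Y i)) :
    Measurable fun ω => equivEstimator L f h x (fun i => X i ω) (fun i => Y i ω) :=
  Finset.measurable_fun_sum _ fun i _ =>
    (((hL.continuous_sphere h x).measurable.comp (hX i)).const_mul _).mul (hY i)

end Measurability

/-- The difference between the two estimators, relative to the sum of the absolute values of the
terms of the second one; it is `0` if all these terms vanish. -/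
def relativeError (p : ℕ) (L : ℝ → ℝ) (f : Sph q → ℝ) (h : ℝ)
    (B : Matrix (Fin (q + 1)) (Fin q) ℝ) (x : Sph q) (X : Fin n → Sph q) (Y : Fin n → ℝ) : ℝ :=
  (localEstimator p L h B x X Y - equivEstimator L f h x X Y) /
    equivEstimator L f h x X fun i => |Y i|

theorem kernel_mul_eq_zero_of_equivEstimator_abs_eq_zero (hL : IsDirectionalKernel L)
    (hmass : 0 < kernelMass q L) (hf : 0 < f x) (hh : 0 < h) {X : Fin n → Sph q} {Y : Fin n → ℝ}
    (habs : equivEstimator L f h x X (fun i => |Y i|) = 0) (i : Fin n) :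
    L ((1 - inner ℝ (x : Amb q) (X i : Amb q)) / h ^ 2) * Y i = 0 := by
  have hn : (0 : ℝ) < n := by exact_mod_cast i.pos
  have hterm (j : Fin n) : 0 ≤ equivKernel L f n h x (X j) * |Y j| :=
    mul_nonneg (mul_nonneg (by positivity)
      (hL.nonneg _ (div_nonneg (one_sub_inner_nonneg x (X j)) (sq_nonneg h)))) (abs_nonneg _)
  have hi := (Finset.sum_eq_zero_iff_of_nonneg fun j _ => hterm j).mp habs i (Finset.mem_univ i)
  have hne : 1 / ((n : ℝ) * h ^ q * kernelMass q L * f x) ≠ 0 := by positivity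
  rw [equivKernel, mul_assoc] at hi
  simpa only [mul_eq_zero, abs_eq_zero] using (mul_eq_zero.mp hi).resolve_left hne

/-- The difference between the two estimators is spread over the terms of the second one in
proportion to their absolute values. -/
theorem localEstimator_eq_sum_mul_one_add (hL : IsDirectionalKernel L)
    (hmass : 0 < kernelMass q L) (hf : 0 < f x) (hh : 0 < h) (X : Fin n → Sph q)
    (Y : Fin n → ℝ) :
    localEstimator p L h B x X Y = ∑ i, equivKernel L f n h x (X i) * Y i *
      (1 + relativeError p L f h B x X Y * SignType.sign (Y i)) := by
  have hterm (i : Fin n) : equivKernel L f n h x (X i) * Y i *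
      (1 + relativeError p L f h B x X Y * SignType.sign (Y i)) =
        equivKernel L f n h x (X i) * Y i +
          relativeError p L f h B x X Y * (equivKernel L f n h x (X i) * |Y i|) := by
    rw [← self_mul_sign (Y i)]
    ring
  have hdiff : relativeError p L f h B x X Y * equivEstimator L f h x X (fun i => |Y i|) =
      localEstimator p L h B x X Y - equivEstimator L f h x X Y := by
    refine div_mul_cancel_of_imp fun habs => ?_
    have hzero := kernel_mul_eq_zero_of_equivEstimator_abs_eq_zero hL hmass hf hh habs
    have hlocal : localEstimator p L h B x X Y = 0 := by
      rw [localEstimator_eq_sum]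
      exact Finset.sum_eq_zero fun i _ => localWeight_mul_eq_zero (hzero i)
    have hequiv : equivEstimator L f h x X Y = 0 :=
      Finset.sum_eq_zero fun i _ => by rw [equivKernel, mul_assoc, hzero i, mul_zero]
    rw [hlocal, hequiv, sub_zero]
  rw [Finset.sum_congr rfl fun i _ => hterm i, Finset.sum_add_distrib, ← Finset.mul_sum]
  exact (add_eq_of_eq_sub' hdiff).symm

end Estimator

section Asymptotics

attribute [local instance] Matrix.normedAddCommGroup

theorem gram_mulVec_single {q p : ℕ} (L : ℝ → ℝ) (t : ℝ) (a : Unit ⊕ (Fin p × Fin q)) :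
    (gram q p L *ᵥ Pi.single (Sum.inl ()) t) a = t * kernelMoment L (regressor p a) := by
  have hgram : gram q p L a (Sum.inl ()) = kernelMoment L (regressor p a) := by
    rw [gram, Matrix.of_apply]
    exact congrArg (kernelMoment L) (funext fun u => mul_one _)
  simp [Matrix.mulVec_single, hgram, mul_comm]

namespace SamplingScheme

variable {q p : ℕ} {Ω : Type*} [MeasurableSpace Ω] {μ : Measure Ω} {m σ f : Sph q → ℝ}
  {L : ℝ → ℝ} {h : ℕ → ℝ} {X : ℕ → Ω → Sph q} {Y ε : ℕ → Ω → ℝ}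
  {B : Sph q → Matrix (Fin (q + 1)) (Fin q) ℝ}

theorem kernelMass_pos (H : SamplingScheme μ m σ f L h X Y ε B) : 0 < kernelMass q L :=
  DirReg.kernelMass_pos H.one_le H.kernel

theorem det_smul_gram_pos (H : SamplingScheme μ m σ f L h X Y ε B) (hp : p ≤ 1) (x : Sph q) :
    0 < (f x • gram q p L).det := by
  rw [Matrix.det_smul]
  exact mul_pos (pow_pos (H.f_pos x) _) (posDef_gram H.one_le hp H.kernel).det_pos

theorem continuous_smul_gram (H : SamplingScheme μ m σ f L h X Y ε B) (p : ℕ) :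
    Continuous fun x => f x • gram q p L :=
  H.continuous_f.smul continuous_const

theorem eventually_ne_zero_and_kernelMassAt_ne_zero (H : SamplingScheme μ m σ f L h X Y ε B) :
    ∀ᶠ n in atTop, n ≠ 0 ∧ kernelMassAt q L (h n) ≠ 0 :=
  (eventually_ne_atTop 0).and ((H.bandwidth.tendsto_nhdsGT.eventually
    (eventually_kernelMassAt_pos H.one_le H.kernel)).mono fun _ hn => hn.ne')

theorem localEstimator_zero_eq_equivEstimator_mul (H : SamplingScheme μ m σ f L h X Y ε B) {n : ℕ}
    (hn : n ≠ 0) (hmass : kernelMassAt q L (h n) ≠ 0) {x : Sph q} {ω : Ω}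
    (hA : localAverage L (fun _ => 1) (fun _ => 1) h X Y B n x ω ≠ 0) :
    localEstimator 0 L (h n) (B x) x (fun i : Fin n => X i ω) (fun i => Y i ω) =
      equivEstimator L f (h n) x (fun i : Fin n => X i ω) (fun i => Y i ω) *
        (1 + (f x * kernelMass q L - localAverage L (fun _ => 1) (fun _ => 1) h X Y B n x ω) /
          localAverage L (fun _ => 1) (fun _ => 1) h X Y B n x ω) := by
  have hn' : (n : ℝ) ≠ 0 := Nat.cast_ne_zero.mpr hn
  have hh := H.bandwidth.pos n
  have hf := H.f_pos x
  have hmass_pos := H.kernelMass_pos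
  rw [localEstimator_zero_eq_div (H.projection x) hh hn hmass, equivEstimator_eq_div (B := B x)]
  simp only [localAverage, mul_one] at hA ⊢
  have hsum := right_ne_zero_of_mul hA
  field_simp
  ring

variable [IsProbabilityMeasure μ]

theorem uniformOP_dist_scaledNormalMatrix (H : SamplingScheme μ m σ f L h X Y ε B) (p : ℕ) :
    UniformOP μ Set.univ fun n x ω =>
      dist (scaledNormalMatrix p L (h n) (B x) x fun i : Fin n => X i ω) (f x • gram q p L) := by
  refine UniformOP.dist_pi fun a => UniformOP.dist_pi fun b => ?_
  have hab := H.uniformOP_localAverage_one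
    ((moderateGrowth_regressor p a).mul (moderateGrowth_regressor p b))
  refine hab.of_abs_le (Eventually.of_forall fun n x _ ω => ?_)
  simp [Real.dist_eq, scaledNormalMatrix, localAverage, gram]

theorem uniformOP_dist_scaledMoments (H : SamplingScheme μ m σ f L h X Y ε B) (p : ℕ) :
    UniformOP μ Set.univ fun n x ω =>
      dist (scaledMoments p L (h n) (B x) x (fun i : Fin n => X i ω) fun i => Y i ω)
        ((f x • gram q p L) *ᵥ Pi.single (Sum.inl ()) (m x)) := by
  refine UniformOP.dist_pi fun a => ?_
  refine (H.uniformOP_localAverage_id (moderateGrowth_regressor p a)).of_abs_le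
    (Eventually.of_forall fun n x _ ω => le_of_eq ?_)
  rw [abs_dist, Real.dist_eq, Matrix.smul_mulVec, Pi.smul_apply, gram_mulVec_single, smul_eq_mul,
    mul_left_comm, ← mul_assoc]
  rfl

theorem negligible_singular (H : SamplingScheme μ m σ f L h X Y ε B) (hp : p ≤ 1) :
    UniformlyNegligible μ Set.univ fun n x =>
      {ω | ¬ IsUnit (normalMatrix p L (h n) (B x) x fun i : Fin n => X i ω).det} := by
  have hdet : Continuous (Matrix.det : Matrix (Unit ⊕ (Fin p × Fin q)) _ ℝ → ℝ) :=
    continuous_id.matrix_det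
  obtain ⟨c, hc, hc_le⟩ := exists_pos_forall_le_of_continuous
    (hdet.comp (H.continuous_smul_gram p)) (H.det_smul_gram_pos hp)
  have hlim := (H.uniformOP_dist_scaledNormalMatrix p).comp_of_isCompact
    (isCompact_range (H.continuous_smul_gram p)) (fun x _ => Set.mem_range_self x)
    fun _ _ => hdet.continuousAt
  refine (hlim.negligible_abs_lt (fun x _ => (hc_le x).trans (le_abs_self _))
    (half_lt_self hc)).mono ?_
  filter_upwards [H.eventually_ne_zero_and_kernelMassAt_ne_zero] with n hn x _ ω hω
  by_contra hbig
  refine hω (isUnit_det_normalMatrix (H.projection x) (H.bandwidth.pos n) hn.1 hn.2 _ ?_)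
  exact abs_pos.mp ((half_pos hc).trans_le (not_lt.mp hbig))

theorem uniformOP_localEstimator_sub (H : SamplingScheme μ m σ f L h X Y ε B) (hp : p ≤ 1) :
    UniformOP μ Set.univ fun n x ω =>
      localEstimator p L (h n) (B x) x (fun i : Fin n => X i ω) (fun i => Y i ω) - m x := by
  have hlim_continuous : Continuous fun x =>
      (f x • gram q p L, (f x • gram q p L) *ᵥ Pi.single (Sum.inl ()) (m x)) := by
    have hsingle : Continuous fun x =>
        (Pi.single (Sum.inl ()) (m x) : Unit ⊕ (Fin p × Fin q) → ℝ) :=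
      (continuous_single _).comp H.continuous_m
    exact (H.continuous_smul_gram p).prodMk ((H.continuous_smul_gram p).matrix_mulVec hsingle)
  have hlim := ((H.uniformOP_dist_scaledNormalMatrix p).dist_prod
    (H.uniformOP_dist_scaledMoments p)).comp_of_isCompact (isCompact_range hlim_continuous)
    (fun x _ => Set.mem_range_self x) (Φ := fun P => (P.1⁻¹ *ᵥ P.2) (Sum.inl ())) (by
      rintro _ ⟨x, rfl⟩
      exact continuousAt_pi.mp (continuousAt_inv_mulVec continuousAt_fst continuousAt_snd
        (H.det_smul_gram_pos hp x).ne') _)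
  refine hlim.of_abs_le ?_
  filter_upwards [H.eventually_ne_zero_and_kernelMassAt_ne_zero] with n hn x _ ω
  rw [localEstimator_eq_inv_mulVec (H.projection x) (H.bandwidth.pos n) hn.1 hn.2,
    Matrix.mulVec_mulVec, Matrix.nonsing_inv_mul _ (H.det_smul_gram_pos hp x).ne'.isUnit,
    Matrix.one_mulVec, Pi.single_eq_same]

theorem uniformOP_equivEstimator_sub (H : SamplingScheme μ m σ f L h X Y ε B) :
    UniformOP μ Set.univ fun n x ω =>
      equivEstimator L f (h n) x (fun i : Fin n => X i ω) (fun i => Y i ω) - m x := by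
  obtain ⟨d, hd, hd_le⟩ := exists_pos_forall_le_of_continuous H.continuous_f H.f_pos
  have hmass := H.kernelMass_pos
  refine ((H.uniformOP_localAverage_id (ModerateGrowth.const 1)).div
    (D := fun _ x _ => kernelMass q L * f x) (c := kernelMass q L * d) (by positivity)
    (.of_le tendsto_const_nhds (Eventually.of_forall fun _ x _ => ?_))).of_abs_le
    (Eventually.of_forall fun n x _ ω => le_of_eq ?_)
  · have hle : kernelMass q L * d ≤ |kernelMass q L * f x| :=
      (mul_le_mul_of_nonneg_left (hd_le x) hmass.le).trans (le_abs_self _)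
    exact (measure_mono_null (fun ω hω => (hle.not_gt hω).elim) measure_empty).le
  · have hf := H.f_pos x
    rw [equivEstimator_eq_div (B := B x), kernelMoment_one H.one_le, sub_div]
    congr 2
    field_simp

theorem uniformOP_localEstimator_sub_equivEstimator (H : SamplingScheme μ m σ f L h X Y ε B)
    (hp : p ≤ 1) :
    UniformOP μ Set.univ fun n x ω =>
      localEstimator p L (h n) (B x) x (fun i : Fin n => X i ω) (fun i => Y i ω) -
        equivEstimator L f (h n) x (fun i : Fin n => X i ω) fun i => Y i ω := by
  simpa only [sub_sub_sub_cancel_right] using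
    (H.uniformOP_localEstimator_sub hp).sub H.uniformOP_equivEstimator_sub

theorem uniformOP_relativeError (H : SamplingScheme μ m σ f L h X Y ε B) (hp : p ≤ 1) :
    UniformOP μ Set.univ fun n x ω =>
      relativeError p L f (h n) (B x) x (fun i : Fin n => X i ω) fun i => Y i ω := by
  obtain ⟨c, hc, hlow⟩ := H.exists_negligible_localAverage_abs_lt
  obtain ⟨D, -, hD⟩ := exists_abs_le_of_continuous H.continuous_f
  have hmass := H.kernelMass_pos
  refine (H.uniformOP_localEstimator_sub_equivEstimator hp).div
    (c := c / (kernelMass q L * (|D| + 1))) (by positivity)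
    (hlow.mono (Eventually.of_forall fun n x _ ω hω => ?_))
  have hf := H.f_pos x
  by_contra hle
  have hmean : c ≤ localAverage L (fun _ => 1) (|·|) h X Y B n x ω := not_lt.mp hle
  refine (Set.mem_ofPred_eq ▸ hω).not_ge ?_
  rw [equivEstimator_eq_div (B := B x)]
  refine le_trans ?_ (le_abs_self _)
  change _ ≤ localAverage L (fun _ => 1) (|·|) h X Y B n x ω / _
  have hfD : f x ≤ |D| + 1 := by linarith [le_abs_self (f x), hD x, le_abs_self D]
  have hmean_nonneg := hc.le.trans hmean
  gcongr

theorem exists_individual_factors (H : SamplingScheme μ m σ f L h X Y ε B) (hp : p ≤ 1) :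
    ∃ r : (n : ℕ) → Sph q → Fin n → Ω → ℝ,
      (∀ n x i, Measurable (r n x i)) ∧
      (∀ n x ω,
        localEstimator p L (h n) (B x) x (fun i : Fin n => X i ω) (fun i => Y i ω) =
          ∑ i : Fin n, equivKernel L f n (h n) x (X i ω) * Y i ω * (1 + r n x i ω)) ∧
      UniformOP μ Set.univ (fun n x ω => ⨆ i : Fin n, |r n x i ω|) := by
  have hX (n : ℕ) (i : Fin n) : Measurable (X i) := (H.model i).measurable_X
  have hY (n : ℕ) (i : Fin n) : Measurable (Y i) := (H.model i).measurable_Y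
  have hsign : Measurable fun t : ℝ => ((SignType.sign t : SignType) : ℝ) := by
    have hite : (fun t : ℝ => ((SignType.sign t : SignType) : ℝ)) =
        fun t => if 0 < t then 1 else if t < 0 then -1 else 0 := by
      funext t
      rw [sign_apply]
      split_ifs <;> simp
    rw [hite]
    exact .ite measurableSet_Ioi measurable_const (.ite measurableSet_Iio measurable_const
      measurable_const)
  refine ⟨fun n x i ω => relativeError p L f (h n) (B x) x (fun i : Fin n => X i ω)
    (fun i => Y i ω) * SignType.sign (Y i ω), fun n x i => ?_, fun n x ω =>
    localEstimator_eq_sum_mul_one_add H.kernel H.kernelMass_pos (H.f_pos x) (H.bandwidth.pos n)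
      _ _, (H.uniformOP_relativeError hp).of_abs_le (Eventually.of_forall fun n x _ ω => ?_)⟩
  · exact (((measurable_localEstimator H.kernel (hX n) (hY n)).sub
      (measurable_equivEstimator H.kernel (hX n) (hY n))).div
      (measurable_equivEstimator H.kernel (hX n) fun i => (hY n i).abs)).mul (hsign.comp (hY n i))
  · rw [abs_of_nonneg (Real.iSup_nonneg fun i => abs_nonneg _)]
    refine Real.iSup_le (fun i => ?_) (abs_nonneg _)
    rw [abs_mul]
    refine mul_le_of_le_one_right (abs_nonneg _) ?_
    rcases (SignType.sign (Y i ω)) with - | - | - <;> simp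

theorem exists_common_factor (H : SamplingScheme μ m σ f L h X Y ε B) (hp : p ≤ 1)
    {S : Set (Sph q)} {c : ℝ} (hc : 0 < c) (hS : ∀ x ∈ S, c ≤ |m x|) :
    ∃ R : ℕ → Sph q → Ω → ℝ,
      (∀ n x, Measurable (R n x)) ∧
      UniformlyNegligible μ S (fun n x =>
        {ω | ¬ (localEstimator p L (h n) (B x) x (fun i : Fin n => X i ω) (fun i => Y i ω) =
          (∑ i : Fin n, equivKernel L f n (h n) x (X i ω) * Y i ω) * (1 + R n x ω))}) ∧
      UniformOP μ S R := by
  have hX (n : ℕ) (i : Fin n) : Measurable (X i) := (H.model i).measurable_X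
  have hY (n : ℕ) (i : Fin n) : Measurable (Y i) := (H.model i).measurable_Y
  have hlow := (H.uniformOP_equivEstimator_sub.subset (Set.subset_univ S)).negligible_abs_lt hS
    (half_lt_self hc)
  refine ⟨fun n x ω =>
    (localEstimator p L (h n) (B x) x (fun i : Fin n => X i ω) (fun i => Y i ω) -
      equivEstimator L f (h n) x (fun i : Fin n => X i ω) fun i => Y i ω) /
        equivEstimator L f (h n) x (fun i : Fin n => X i ω) fun i => Y i ω, fun n x => ?_,
    hlow.mono (Eventually.of_forall fun n x _ ω hω => ?_),
    ((H.uniformOP_localEstimator_sub_equivEstimator hp).subset (Set.subset_univ S)).div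
      (half_pos hc) hlow⟩
  · exact ((measurable_localEstimator H.kernel (hX n) (hY n)).sub
      (measurable_equivEstimator H.kernel (hX n) (hY n))).div
      (measurable_equivEstimator H.kernel (hX n) (hY n))
  · by_contra hbig
    refine hω ?_
    have hne : equivEstimator L f (h n) x (fun i : Fin n => X i ω) (fun i => Y i ω) ≠ 0 :=
      abs_pos.mp ((half_pos hc).trans_le (not_lt.mp hbig))
    change _ = equivEstimator L f (h n) x (fun i : Fin n => X i ω) (fun i => Y i ω) * (1 + _)
    field_simp
    ring

theorem exists_common_factor_of_degree_zero (H : SamplingScheme μ m σ f L h X Y ε B)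
    (S : Set (Sph q)) :
    ∃ R : ℕ → Sph q → Ω → ℝ,
      (∀ n x, Measurable (R n x)) ∧
      UniformlyNegligible μ S (fun n x =>
        {ω | ¬ (localEstimator 0 L (h n) (B x) x (fun i : Fin n => X i ω) (fun i => Y i ω) =
          (∑ i : Fin n, equivKernel L f n (h n) x (X i ω) * Y i ω) * (1 + R n x ω))}) ∧
      UniformOP μ S R := by
  have hX (n : ℕ) (i : Fin n) : Measurable (X i) := (H.model i).measurable_X
  obtain ⟨d, hd, hd_le⟩ := exists_pos_forall_le_of_continuous H.continuous_f H.f_pos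
  have hmass := H.kernelMass_pos
  set A := localAverage L (fun _ => 1) (fun _ => 1) h X Y B
  have hA := (H.uniformOP_localAverage_one (ModerateGrowth.const 1)).subset (Set.subset_univ S)
  rw [kernelMoment_one H.one_le] at hA
  have hlow := hA.negligible_abs_lt (fun x _ => (mul_le_mul_of_nonneg_right (hd_le x)
    hmass.le).trans (le_abs_self _)) (half_lt_self (mul_pos hd hmass))
  refine ⟨fun n x ω => (f x * kernelMass q L - A n x ω) / A n x ω, fun n x => ?_,
    hlow.mono ?_, (hA.div (half_pos (mul_pos hd hmass)) hlow).of_abs_le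
    (Eventually.of_forall fun n x _ ω => by rw [abs_div, abs_div, abs_sub_comm])⟩
  · have hAmeas : Measurable (A n x) := (Finset.measurable_fun_sum _ fun i _ =>
      ((continuous_localKernel H.kernel continuous_const _ _ _).measurable.comp
        (hX n i)).mul_const 1).const_mul _
    exact (hAmeas.const_sub _).div hAmeas
  · filter_upwards [H.eventually_ne_zero_and_kernelMassAt_ne_zero] with n hn x _ ω hω
    by_contra hbig
    refine hω ?_
    exact H.localEstimator_zero_eq_equivEstimator_mul hn.1 hn.2
      (abs_pos.mp ((half_pos (mul_pos hd hmass)).trans_le (not_lt.mp hbig)))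

end SamplingScheme

end Asymptotics

theorem SamplingScheme.of_smoothDesign {q : ℕ} {Ω : Type*} [MeasurableSpace Ω] {μ : Measure Ω}
    {m σ f : Sph q → ℝ} {L : ℝ → ℝ} {h : ℕ → ℝ} {X : ℕ → Ω → Sph q} {Y ε : ℕ → Ω → ℝ}
    {B : Sph q → Matrix (Fin (q + 1)) (Fin q) ℝ} (hq : 1 ≤ q)
    (hB : ∀ x, IsProjectionMatrix x (B x))
    (hmodel : ∀ i, RegressionModel μ m σ f (X i) (Y i) (ε i))
    (hindep : iIndepFun (fun i ω => (X i ω, Y i ω)) μ)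
    (hident : ∀ i, IdentDistrib (fun ω => (X i ω, Y i ω)) (fun ω => (X 0 ω, Y 0 ω)) μ μ)
    (hsmooth : SmoothDesign m f) (hnoise : RegularNoise σ) (hL : IsDirectionalKernel L)
    (hh : IsBandwidth q h) : SamplingScheme μ m σ f L h X Y ε B where
  one_le := hq
  projection := hB
  model := hmodel
  indep _ _ hij := hindep.indepFun hij
  ident := hident
  continuous_m := continuous_of_contDiffOn_radialExt hsmooth.contDiff_m
  continuous_σ := hnoise.continuous
  continuous_f := continuous_of_contDiffOn_radialExt hsmooth.contDiff_f
  f_pos x := by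
    obtain ⟨c, hc, hle⟩ := hsmooth.f_lower
    exact hc.trans_le (hle x)
  nondegenerate x := by
    obtain ⟨c, hc, hle⟩ := hnoise.sq_lower
    exact .inr (pow_ne_zero_iff two_ne_zero |>.mp (hc.trans_le (hle x)).ne')
  kernel := hL
  bandwidth := hh

end DirReg

end

theorem corollary1_general {q : ℕ} {Ω : Type*} [MeasurableSpace Ω] {μ : Measure Ω}
    [IsProbabilityMeasure μ] {m σ f : DirReg.Sph q → ℝ} {L : ℝ → ℝ} {h : ℕ → ℝ}
    {X : ℕ → Ω → DirReg.Sph q} {Y ε : ℕ → Ω → ℝ}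
    {B : DirReg.Sph q → Matrix (Fin (q + 1)) (Fin q) ℝ}
    (H : DirReg.SamplingScheme μ m σ f L h X Y ε B) {p : ℕ} (hp : p = 0 ∨ p = 1) :
    DirReg.UniformlyNegligible μ Set.univ (fun (n : ℕ) (x : DirReg.Sph q) =>
      {ω | ¬ IsUnit
        (DirReg.normalMatrix p L (h n) (B x) x (fun i : Fin n => X i ω)).det}) ∧
    (∃ r : (n : ℕ) → DirReg.Sph q → Fin n → Ω → ℝ,
      (∀ n x i, Measurable (r n x i)) ∧
      (∀ n x ω,
        DirReg.localEstimator p L (h n) (B x) x (fun i : Fin n => X i ω) (fun i => Y i ω) =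
          ∑ i : Fin n, DirReg.equivKernel L f n (h n) x (X i ω) * Y i ω * (1 + r n x i ω)) ∧
      DirReg.UniformOP μ Set.univ (fun n x ω => ⨆ i : Fin n, |r n x i ω|)) ∧
    (∀ S : Set (DirReg.Sph q), (p = 0 ∨ ∃ c : ℝ, 0 < c ∧ ∀ x ∈ S, c ≤ |m x|) →
      ∃ R : ℕ → DirReg.Sph q → Ω → ℝ,
        (∀ n x, Measurable (R n x)) ∧
        DirReg.UniformlyNegligible μ S (fun n x =>
          {ω | ¬ (DirReg.localEstimator p L (h n) (B x) x
              (fun i : Fin n => X i ω) (fun i => Y i ω) =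
            (∑ i : Fin n, DirReg.equivKernel L f n (h n) x (X i ω) * Y i ω) * (1 + R n x ω))}) ∧
        DirReg.UniformOP μ S R) := by
  have hp_le : p ≤ 1 := by lia
  refine ⟨H.negligible_singular hp_le, H.exists_individual_factors hp_le, fun S hS => ?_⟩
  rcases hS with rfl | ⟨c, hc, hS⟩
  · exact H.exists_common_factor_of_degree_zero S
  · exact H.exists_common_factor hp_le hc hS

theorem corollary1 {q : ℕ} (hq : 1 ≤ q)
    {Ω : Type*} [MeasurableSpace Ω] (μ : Measure Ω) [IsProbabilityMeasure μ]
    (m σ f : DirReg.Sph q → ℝ) (L : ℝ → ℝ) (h : ℕ → ℝ)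
    (X : ℕ → Ω → DirReg.Sph q) (Y ε : ℕ → Ω → ℝ)
    (B : DirReg.Sph q → Matrix (Fin (q + 1)) (Fin q) ℝ)
    (hB : ∀ x, DirReg.IsProjectionMatrix x (B x))
    (hmodel : ∀ i, DirReg.RegressionModel μ m σ f (X i) (Y i) (ε i))
    (hindep : iIndepFun (fun i ω => (X i ω, Y i ω)) μ)
    (hident : ∀ i, IdentDistrib (fun ω => (X i ω, Y i ω)) (fun ω => (X 0 ω, Y 0 ω)) μ μ)
    (hsmooth : DirReg.SmoothDesign m f)
    (hnoise : DirReg.RegularNoise σ)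
    (hL : DirReg.IsDirectionalKernel L)
    (hh : DirReg.IsBandwidth q h)
    (p : ℕ) (hp : p = 0 ∨ p = 1) :
    -- the estimator is well defined with probability tending to one
    DirReg.UniformlyNegligible μ Set.univ (fun (n : ℕ) (x : DirReg.Sph q) =>
      {ω | ¬ IsUnit
        (DirReg.normalMatrix p L (h n) (B x) x (fun i : Fin n => X i ω)).det}) ∧
    -- the estimator is the sum of the terms `L*_h(x, X_i) Y_i (1 + o_P(1))`
    (∃ r : (n : ℕ) → DirReg.Sph q → Fin n → Ω → ℝ,
      (∀ n x i, Measurable (r n x i)) ∧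
      (∀ n x ω,
        DirReg.localEstimator p L (h n) (B x) x (fun i : Fin n => X i ω) (fun i => Y i ω) =
          ∑ i : Fin n, DirReg.equivKernel L f n (h n) x (X i ω) * Y i ω * (1 + r n x i ω)) ∧
      DirReg.UniformOP μ Set.univ (fun n x ω => ⨆ i : Fin n, |r n x i ω|)) ∧
    -- one common factor `1 + o_P(1)`: everywhere for `p = 0`, and away from the zeros of `m`
    -- for `p = 1`
    (∀ S : Set (DirReg.Sph q), (p = 0 ∨ ∃ c : ℝ, 0 < c ∧ ∀ x ∈ S, c ≤ |m x|) →
      ∃ R : ℕ → DirReg.Sph q → Ω → ℝ,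
        (∀ n x, Measurable (R n x)) ∧
        DirReg.UniformlyNegligible μ S (fun n x =>
          {ω | ¬ (DirReg.localEstimator p L (h n) (B x) x
              (fun i : Fin n => X i ω) (fun i => Y i ω) =
            (∑ i : Fin n, DirReg.equivKernel L f n (h n) x (X i ω) * Y i ω) * (1 + R n x ω))}) ∧
        DirReg.UniformOP μ S R) :=
  corollary1_general (.of_smoothDesign hq hB hmodel hindep hident hsmooth hnoise hL hh) hp
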